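/- Notation. Let $R=(r_1,\dots,r_m)$ and $C=(c_1,\dots,c_n)$ be vectors of positive integers with $r_1+\dots+r_m=c_1+\dots+c_n$ (margins). Let $A_0(R,C)$ be the set of all $m\times n$ matrices with entries in $\{0,1\}$, row sums $R$ and column sums $C$, and let $P_0(R,C)$ be the polytope of all real $m\times n$ matrices $X=(x_{ij})$ with row sums $R$, column sums $C$ and $0\le x_{ij}\le 1$ for all $i,j$. We say that $P_0(R,C)$ has non-empty interior if it contains a matrix $(y_{ij})$ with $0<y_{ij}<1$ for all $i,j$. In that case the maximum entropy matrix $Z_0$ is the unique matrix in $P_0(R,C)$ at which $$h(X)=\sum_{i,j}\Bigl(x_{ij}\ln\frac1{x_{ij}}+(1-x_{ij})\ln\frac1{1-x_{ij}}\Bigr)$$ (with $0\ln\frac10=0$) attains its maximum on $P_0(R,C)$. For an $m\times n$ matrix $B=(b_{ij})$ and $S\subset\{1,\dots,m\}\times\{1,\dots,n\}$ put $\sigma_S(B)=\sum_{(i,j)\in S}b_{ij}$. Corollary 6.2. Fix real numbers $\kappa>0$ and $0<\delta<1$. Then there exists a number $q=q(\kappa,\delta)>0$ such that the following holds. Let $(R,C)$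 be margins such that $n\ge m>q$ and $P_0(R,C)$ has non-empty interior, and let $Z_0\in P_0(R,C)$ be the maximum entropy matrix. Let $S\subset\{(i,j): i=1,\dots,m;\ j=1,\dots,n\}$ be a set such that $\sigma_S(Z_0)\ge\delta mn$, and let $$\epsilon=\delta\,\frac{\ln n}{\sqrt m}.$$ If $\epsilon\le 1$, then for $D$ chosen uniformly at random from $A_0(R,C)$, $$\mathbf{Pr}\bigl\{(1-\epsilon)\,\sigma_S(Z_0)\le\sigma_S(D)\le(1+\epsilon)\,\sigma_S(Z_0)\bigr\}\ \ge\ 1-n^{-\kappa n}.$$ -/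

import Mathlib

namespace ZeroOneMargins

/-- The set `A₀(R, C)` of 0-1 matrices with row sums `R` and column sums `C`
(the entries are viewed as real numbers). -/
def zeroOneMatrices {m n : ℕ} (R : Fin m → ℕ) (C : Fin n → ℕ) :
    Set (Matrix (Fin m) (Fin n) ℝ) :=
  {D | (∀ i, ∑ j, D i j = R i) ∧ (∀ j, ∑ i, D i j = C j) ∧ ∀ i j, D i j = 0 ∨ D i j = 1}

/-- The polytope `P₀(R, C)` of real matrices with row sums `R`, column sums `C` and entries
between `0` and `1`. -/
def polytope {m n : ℕ} (R : Fin m → ℕ) (C : Fin n → ℕ) :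
    Set (Matrix (Fin m) (Fin n) ℝ) :=
  {X | (∀ i, ∑ j, X i j = R i) ∧ (∀ j, ∑ i, X i j = C j) ∧ ∀ i j, 0 ≤ X i j ∧ X i j ≤ 1}

/-- The polytope has a non-empty interior: it contains a matrix with all entries strictly
between `0` and `1`. -/
def HasInterior {m n : ℕ} (R : Fin m → ℕ) (C : Fin n → ℕ) : Prop :=
  ∃ Y ∈ polytope R C, ∀ i j, 0 < Y i j ∧ Y i j < 1

/-- The entropy `h(X) = ∑ x ln (1/x) + (1 - x) ln (1/(1 - x))`, summed over all entries `x`. -/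
noncomputable def entropy {m n : ℕ} (X : Matrix (Fin m) (Fin n) ℝ) : ℝ :=
  ∑ i, ∑ j, Real.binEntropy (X i j)

/-- `Z` is the maximum entropy matrix of the margins `(R, C)`: a point of the polytope at which
the entropy attains its maximum over the polytope. -/
def IsMaxEntropyMatrix {m n : ℕ} (R : Fin m → ℕ) (C : Fin n → ℕ)
    (Z : Matrix (Fin m) (Fin n) ℝ) : Prop :=
  Z ∈ polytope R C ∧ ∀ X ∈ polytope R C, entropy X ≤ entropy Z

/-- The sum `σ_S(B)` of the entries of `B` indexed by `S`. -/
def entrySum {m n : ℕ} (S : Finset (Fin m × Fin n)) (B : Matrix (Fin m) (Fin n) ℝ) : ℝ :=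
  ∑ p ∈ S, B p.1 p.2

/-- The probability of the event `E` under the uniform measure on the (finite) set `A`. -/
noncomputable def uniformProb {α : Type*} (A E : Set α) : ℝ :=
  ((A ∩ E).ncard : ℝ) / (A.ncard : ℝ)

theorem finite_zeroOneMatrices {m n : ℕ} (R : Fin m → ℕ) (C : Fin n → ℕ) :
    (zeroOneMatrices R C).Finite := by
  have h : (Set.pi Set.univ fun _ : Fin m => Set.pi Set.univ fun _ : Fin n =>
      ({0, 1} : Set ℝ)).Finite :=
    Set.Finite.pi fun _ => Set.Finite.pi fun _ => Set.toFinite _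
  refine Set.Finite.subset h ?_
  intro D hD i _ j _
  simpa using hD.2.2 i j

/-- The maximum entropy matrix exists and is unique as soon as the polytope is not empty. -/
theorem existsUnique_isMaxEntropyMatrix {m n : ℕ} (R : Fin m → ℕ) (C : Fin n → ℕ)
    (hne : (polytope R C).Nonempty) : ∃! Z, IsMaxEntropyMatrix R C Z := by
  have hcont : Continuous (entropy : Matrix (Fin m) (Fin n) ℝ → ℝ) := by
    unfold entropy
    exact continuous_finsetSum _ fun i _ => continuous_finsetSum _ fun j _ =>
      Real.binEntropy_continuous.comp (continuous_apply_apply i j)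
  have hcomp : IsCompact (polytope R C) := by
    have hbox : IsCompact (Set.pi Set.univ fun _ : Fin m => Set.pi Set.univ fun _ : Fin n =>
        Set.Icc (0 : ℝ) 1) :=
      isCompact_univ_pi fun _ => isCompact_univ_pi fun _ => isCompact_Icc
    refine IsCompact.of_isClosed_subset hbox ?_ ?_
    · have h1 : IsClosed {X : Fin m → Fin n → ℝ | ∀ i, ∑ j, X i j = R i} := by
        simp only [Set.ofPred_forall]
        exact isClosed_iInter fun i => isClosed_eq (by fun_prop) continuous_const
      have h2 : IsClosed {X : Fin m → Fin n → ℝ | ∀ j, ∑ i, X i j = C j} := by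
        simp only [Set.ofPred_forall]
        exact isClosed_iInter fun i => isClosed_eq (by fun_prop) continuous_const
      have h3 : IsClosed {X : Fin m → Fin n → ℝ | ∀ i j, 0 ≤ X i j ∧ X i j ≤ 1} := by
        simp only [Set.ofPred_forall]
        exact isClosed_iInter fun i => isClosed_iInter fun j =>
          IsClosed.and (isClosed_le continuous_const (continuous_apply_apply i j))
            (isClosed_le (continuous_apply_apply i j) continuous_const)
      exact h1.inter (h2.inter h3)
    · intro X hX i _ j _
      exact hX.2.2 i j
  obtain ⟨Z, hZ, hmax⟩ := hcomp.exists_isMaxOn hne hcont.continuousOn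
  refine ⟨Z, ⟨hZ, fun X hX => hmax hX⟩, ?_⟩
  rintro W ⟨hW, hWmax⟩
  by_contra hne
  have hmid : ((fun i j => (1 / 2 : ℝ) * W i j + (1 / 2) * Z i j) :
      Matrix (Fin m) (Fin n) ℝ) ∈ polytope R C := by
    refine ⟨fun i => ?_, fun j => ?_, fun i j => ?_⟩
    · rw [Finset.sum_add_distrib, ← Finset.mul_sum, ← Finset.mul_sum, hW.1 i, hZ.1 i]; ring
    · rw [Finset.sum_add_distrib, ← Finset.mul_sum, ← Finset.mul_sum, hW.2.1 j, hZ.2.1 j]; ring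
    · have h1 := hW.2.2 i j
      have h2 := hZ.2.2 i j
      constructor <;> linarith [h1.1, h1.2, h2.1, h2.2]
  have hle : ∀ i j, (1 / 2 : ℝ) * Real.binEntropy (W i j) + (1 / 2) * Real.binEntropy (Z i j)
      ≤ Real.binEntropy ((1 / 2 : ℝ) * W i j + (1 / 2) * Z i j) := fun i j =>
    Real.strictConcave_binEntropy.concaveOn.2 (hW.2.2 i j) (hZ.2.2 i j)
      (by norm_num) (by norm_num) (by norm_num)
  obtain ⟨i, j, hij⟩ : ∃ i j, W i j ≠ Z i j := by
    by_contra! h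
    exact hne (by ext i j; exact h i j)
  have hlt : (1 / 2 : ℝ) * Real.binEntropy (W i j) + (1 / 2) * Real.binEntropy (Z i j)
      < Real.binEntropy ((1 / 2 : ℝ) * W i j + (1 / 2) * Z i j) :=
    Real.strictConcave_binEntropy.2 (hW.2.2 i j) (hZ.2.2 i j) hij
      (by norm_num) (by norm_num) (by norm_num)
  have hsum : (1 / 2 : ℝ) * entropy W + (1 / 2) * entropy Z
      < entropy (fun i j => (1 / 2 : ℝ) * W i j + (1 / 2) * Z i j) := by
    unfold entropy
    simp only [Finset.mul_sum, ← Finset.sum_add_distrib]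
    exact Finset.sum_lt_sum (fun i _ => Finset.sum_le_sum fun j _ => hle i j)
      ⟨i, Finset.mem_univ _, Finset.sum_lt_sum (fun j _ => hle i j) ⟨j, Finset.mem_univ _, hlt⟩⟩
  have h1 := hWmax _ hmid
  have h2 := hWmax _ hZ
  have h3 : entropy _ ≤ entropy Z := hmax hmid
  linarith

end ZeroOneMargins

/-! The proof compares two counts with `exp (entropy Z)`. For an upper bound on the number of
deviating matrices, let the entries be independent Bernoulli variables with means `Z`. The first
order condition at the entropy maximum gives every matrix in `zeroOneMatrices R C` probability at
least `exp (-entropy Z)`, so Chernoff's inequality leaves at most `2 * exp (entropy Z - ε ^ 2 *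
entrySum S Z / 4)` of them that deviate (`ncard_deviation_le`).

The main work is the lower bound `exp (entropy Z) / (4 * n) ^ (2 * n)` for the total count
(`entropy_le_log_ncard`), obtained by a tensor power argument. Let `N K` count the 0-1 arrays with
`K` layers and margins `K * R`, `K * C`. Rounding `K * Z` to integers and multiplying binomial
coefficients shows that `log (N K) / K` is asymptotically at least `entropy Z`. Conversely `N (2 *
K)` is at most `N K ^ 2` times a factor polynomial in `K`, so halving repeatedly from `2 ^ k` down
to `1` loses only a bounded amount per layer.

The halving inequality is a correlation inequality. Cut an array into two halves and fix their
overlay. The cells covered once form a bipartite multigraph with even degrees, and a split of them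
is a two-colouring; both halves have the right margins when the colouring is balanced at every
vertex. The Walsh coefficients of "balanced on the left" and "balanced on the right" have
nonnegative products, so by Parseval the two events are positively correlated. Each has probability
at least `1 / ∏ (degree + 1)`, because zero is the most likely signed degree vector. -/

namespace ZeroOneMargins

open Finset

set_option linter.unusedSectionVars false

/-! ### Balanced two-colourings and their Walsh coefficients -/

section Signs

variable {E I J : Type*} [Fintype E] [DecidableEq E] [Fintype I] [DecidableEq I] [Fintype J] [DecidableEq J]

/-- The sign attached to a colour. -/
def sgn (b : Bool) : ℤ := if b then 1 else -1

/-- The signed degree of the vertex `i` in the two-colouring `z` of the edges. -/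
def imbalance (p : E → I) (z : E → Bool) (i : I) : ℤ := ∑ e, if p e = i then sgn (z e) else 0

/-- The Walsh character indexed by `t` at `z`. -/
def walsh (t z : E → Bool) : ℤ := ∏ e, if t e then sgn (z e) else 1

/-- The Walsh coefficient of the set of colourings with signed degrees `s`. -/
def walshCoeff (p : E → I) (s : I → ℤ) (t : E → Bool) : ℤ :=
  ∑ z : E → Bool, if imbalance p z = s then walsh t z else 0

theorem abs_sgn (b : Bool) : |sgn b| = 1 := by cases b <;> simp [sgn]

theorem abs_imbalance_le (p : E → I) (z : E → Bool) (i : I) :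
    |imbalance p z i| ≤ Fintype.card E := by
  unfold imbalance
  refine (abs_sum_le_sum_abs _ _).trans ?_
  calc _ ≤ ∑ _e : E, (1 : ℤ) := by
        refine sum_le_sum fun e _ => ?_
        split_ifs
        · exact (abs_sgn _).le
        · simp
    _ = _ := by simp

theorem stdAddChar_sum {α : Type*} {N : ℕ} [NeZero N] (s : Finset α) (f : α → ZMod N) :
    ZMod.stdAddChar (∑ a ∈ s, f a) = ∏ a ∈ s, ZMod.stdAddChar (f a) := by
  induction s using Finset.cons_induction with
  | empty => simp
  | cons a s ha ih => rw [sum_cons, prod_cons, AddChar.map_add_eq_mul, ih]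

/-- A Walsh coefficient as an average over the discrete torus. -/
theorem walshCoeff_eq_sum (p : E → I) (s : I → ℤ) (t : E → Bool) (N : ℕ) [NeZero N]
    (hN : ∀ i, |s i| + Fintype.card E < N) :
    (N : ℂ) ^ Fintype.card I * walshCoeff p s t =
      ∑ θ : I → ZMod N, (∏ i, ZMod.stdAddChar (-(θ i * (s i : ZMod N)))) *
        ∏ e, (if t e then 2 * Complex.I * ((ZMod.stdAddChar (θ (p e))).im : ℂ)
          else 2 * ((ZMod.stdAddChar (θ (p e))).re : ℂ)) := by
  -- Each edge contributes twice a cosine, or `2 * I` times a sine when its sign enters the Walsh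
  -- character.
  have hterm : ∀ (θ : ZMod N) (b : Bool),
      (if b then 2 * Complex.I * ((ZMod.stdAddChar θ).im : ℂ)
          else 2 * ((ZMod.stdAddChar θ).re : ℂ)) =
        ∑ c : Bool, ZMod.stdAddChar (θ * (sgn c : ZMod N)) *
          ((if b then sgn c else 1 : ℤ) : ℂ) := by
    intro θ b
    have hc : ZMod.stdAddChar (-θ) = (starRingEnd ℂ) (ZMod.stdAddChar θ) :=
      AddChar.map_neg_eq_conj _ _
    rw [Fintype.sum_bool]
    cases b <;> simp only [sgn] <;> simp [hc] <;> apply Complex.ext <;> simp <;> ring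
  have hprod : ∀ θ : I → ZMod N,
      (∏ e, (if t e then 2 * Complex.I * ((ZMod.stdAddChar (θ (p e))).im : ℂ)
          else 2 * ((ZMod.stdAddChar (θ (p e))).re : ℂ))) =
      ∑ z : E → Bool, (∏ i, ZMod.stdAddChar (θ i * (imbalance p z i : ZMod N))) *
        (walsh t z : ℂ) := by
    intro θ
    simp_rw [hterm]
    rw [Fintype.prod_sum]
    refine sum_congr rfl fun z _ => ?_
    rw [prod_mul_distrib]
    congr 1
    · simp only [imbalance, Int.cast_sum, mul_sum, stdAddChar_sum]
      rw [prod_comm]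
      refine prod_congr rfl fun e _ => ?_
      rw [prod_eq_single (p e)]
      · simp
      · intro i _ hi
        simp [hi.symm]
      · simp
    · simp [walsh]
  simp_rw [hprod, mul_sum]
  rw [sum_comm, walshCoeff, Int.cast_sum, mul_sum]
  refine sum_congr rfl fun z _ => ?_
  have hθ : ∀ θ : I → ZMod N, (∏ i, ZMod.stdAddChar (-(θ i * (s i : ZMod N)))) *
      ((∏ i, ZMod.stdAddChar (θ i * (imbalance p z i : ZMod N))) * (walsh t z : ℂ)) =
      (∏ i, ZMod.stdAddChar (θ i * ((imbalance p z i - s i : ℤ) : ZMod N))) * (walsh t z : ℂ) := by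
    intro θ
    rw [← mul_assoc, ← prod_mul_distrib]
    congr 1
    refine prod_congr rfl fun i _ => ?_
    rw [← AddChar.map_add_eq_mul]
    congr 1
    push_cast
    ring
  simp_rw [hθ]
  rw [← sum_mul, ← Fintype.prod_sum (fun i (x : ZMod N) =>
    ZMod.stdAddChar (x * ((imbalance p z i - s i : ℤ) : ZMod N)))]
  simp_rw [AddChar.sum_mulShift _ (ZMod.isPrimitive_stdAddChar N), ZMod.card]
  by_cases h : imbalance p z = s
  · simp [h]
  · obtain ⟨i, hi⟩ := Function.ne_iff.1 h
    -- The modulus exceeds every possible difference of signed degrees, so congruence modulo `N`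
    -- means equality.
    have hz : ((imbalance p z i - s i : ℤ) : ZMod N) ≠ 0 := by
      rw [Ne, ZMod.intCast_zmod_eq_zero_iff_dvd]
      intro hd
      have h1 := Int.le_of_dvd (abs_pos.2 (sub_ne_zero.2 hi)) ((dvd_abs _ _).2 hd)
      have h2 := abs_sub (imbalance p z i) (s i)
      have h3 := abs_imbalance_le p z i
      have h4 := hN i
      linarith
    rw [prod_eq_zero (mem_univ i) (by rw [if_neg hz, Nat.cast_zero])]
    simp [h]

/-- The real trigonometric sum behind the Walsh coefficient of the balanced colourings. -/
noncomputable def torusSum (p : E → I) (N : ℕ) [NeZero N] (t : E → Bool) : ℝ :=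
  ∑ θ : I → ZMod N, ∏ e, (if t e then 2 * (ZMod.stdAddChar (θ (p e))).im
    else 2 * (ZMod.stdAddChar (θ (p e))).re)

theorem walshCoeff_zero_eq (p : E → I) (t : E → Bool) (N : ℕ) [NeZero N]
    (hN : Fintype.card E < N) :
    (N : ℂ) ^ Fintype.card I * walshCoeff p 0 t =
      Complex.I ^ #{e | t e = true} * torusSum p N t := by
  rw [walshCoeff_eq_sum p 0 t N (by simpa using fun _ => hN), torusSum, Complex.ofReal_sum, mul_sum]
  refine sum_congr rfl fun θ _ => ?_
  rw [← prod_const, prod_filter, Complex.ofReal_prod, ← prod_mul_distrib]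
  simp only [Pi.zero_apply, Int.cast_zero, mul_zero, neg_zero, AddChar.map_zero_eq_one,
    prod_const_one, one_mul]
  refine prod_congr rfl fun e _ => ?_
  split_ifs <;> push_cast <;> ring

theorem prod_fiber {M : Type*} [CommMonoid M] (p : E → I) (f : E → M) :
    ∏ e, f e = ∏ i, ∏ e with p e = i, f e :=
  (prod_fiberwise _ _ _).symm

theorem prod_ite_mul_eq_pow {α : Type*} (s : Finset α) (t : α → Bool) (a b : ℝ) :
    ∏ e ∈ s, (if t e then a else b) =
      a ^ #{e ∈ s | t e = true} * b ^ #{e ∈ s | ¬ t e = true} := by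
  rw [prod_ite, prod_const, prod_const]

theorem prod_torus_eq (p : E → I) (N : ℕ) [NeZero N] (t : E → Bool) (θ : I → ZMod N) :
    ∏ e, (if t e then 2 * (ZMod.stdAddChar (θ (p e))).im
      else 2 * (ZMod.stdAddChar (θ (p e))).re) =
    ∏ i, ((2 * (ZMod.stdAddChar (θ i)).im) ^ #{e ∈ ({e | p e = i} : Finset E) | t e = true} *
      (2 * (ZMod.stdAddChar (θ i)).re) ^ #{e ∈ ({e | p e = i} : Finset E) | ¬ t e = true}) := by
  rw [prod_fiber p]
  refine prod_congr rfl fun i _ => ?_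
  rw [← prod_ite_mul_eq_pow]
  refine prod_congr rfl fun e he => ?_
  rw [(mem_filter.1 he).2]

/-- At each vertex both the sine and the cosine occur to an even power, so every summand is
nonnegative. -/
theorem torusSum_nonneg_of_even (p : E → I) (N : ℕ) [NeZero N] (t : E → Bool)
    (hp : ∀ i, Even #{e | p e = i})
    (ht : ∀ i, Even #{e ∈ ({e | p e = i} : Finset E) | t e = true}) : 0 ≤ torusSum p N t := by
  refine sum_nonneg fun θ _ => ?_
  rw [prod_torus_eq]
  refine prod_nonneg fun i _ => mul_nonneg ((ht i).pow_nonneg _) (Even.pow_nonneg ?_ _)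
  have h := card_filter_add_card_filter_not (s := ({e | p e = i} : Finset E))
    (fun e => t e = true)
  have h1 := hp i
  rw [← h, Nat.even_add] at h1
  exact h1.1 (ht i)

/-- The reflection `θ i ↦ -θ i` permutes the summands and changes their sign, since the sine at `i`
has an odd exponent. -/
theorem torusSum_eq_zero_of_odd (p : E → I) (N : ℕ) [NeZero N] (t : E → Bool) (i : I)
    (ht : Odd #{e ∈ ({e | p e = i} : Finset E) | t e = true}) : torusSum p N t = 0 := by
  let σ : (I → ZMod N) ≃ (I → ZMod N) := Equiv.piCongrRight fun j =>
    if j = i then Equiv.neg (ZMod N) else Equiv.refl _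
  have h : torusSum p N t = - torusSum p N t := by
    conv_lhs => rw [torusSum, ← Equiv.sum_comp σ]
    rw [torusSum, ← sum_neg_distrib]
    refine sum_congr rfl fun θ _ => ?_
    rw [prod_torus_eq, prod_torus_eq, Fintype.prod_eq_mul_prod_compl i,
      Fintype.prod_eq_mul_prod_compl (a := i), ← neg_mul]
    congr 1
    · have hc : ZMod.stdAddChar (-(θ i)) = (starRingEnd ℂ) (ZMod.stdAddChar (θ i)) :=
        AddChar.map_neg_eq_conj _ _
      have : σ θ i = - θ i := by simp [σ]
      rw [this, hc, Complex.conj_im, Complex.conj_re, mul_neg, ht.neg_pow, neg_mul]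
    · refine prod_congr rfl fun j hj => ?_
      have hj : j ≠ i := by simpa using hj
      have : σ θ j = θ j := by simp [σ, hj]
      rw [this]
  linarith

/-- If `t` has an odd degree somewhere, one factor vanishes. Otherwise `t` has an even number of
edges, so the two equal powers of `I` multiply to `1` and two nonnegative torus sums remain. -/
theorem walshCoeff_mul_nonneg (p : E → I) (q : E → J) (hp : ∀ i, Even #{e | p e = i})
    (hq : ∀ j, Even #{e | q e = j}) (t : E → Bool) :
    0 ≤ walshCoeff p 0 t * walshCoeff q 0 t := by
  set N := Fintype.card E + 1 with hN
  have hP := walshCoeff_zero_eq p t N (by omega)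
  have hQ := walshCoeff_zero_eq q t N (by omega)
  have hN0 : (N : ℂ) ≠ 0 := Nat.cast_ne_zero.2 (NeZero.ne N)
  by_cases h1 : ∀ i, Even #{e ∈ ({e | p e = i} : Finset E) | t e = true}
  · by_cases h2 : ∀ j, Even #{e ∈ ({e | q e = j} : Finset E) | t e = true}
    · have hT : Even #{e | t e = true} := by
        rw [card_eq_sum_card_fiberwise (f := p) (t := univ) (by simp [Set.MapsTo])]
        refine even_sum _ fun i _ => ?_
        have := h1 i
        rw [filter_filter] at this ⊢
        simpa only [and_comm] using this
      obtain ⟨k, hk⟩ := hT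
      have h : ((N : ℝ) ^ Fintype.card I * (N : ℝ) ^ Fintype.card J) *
          ((walshCoeff p 0 t * walshCoeff q 0 t : ℤ) : ℝ) = torusSum p N t * torusSum q N t := by
        have hI : (Complex.I ^ #{e | t e = true}) * (Complex.I ^ #{e | t e = true}) = 1 := by
          rw [hk, ← mul_pow, Complex.I_mul_I, ← two_mul, pow_mul]
          simp
        have : (((N : ℝ) ^ Fintype.card I * (N : ℝ) ^ Fintype.card J) *
          ((walshCoeff p 0 t * walshCoeff q 0 t : ℤ) : ℝ) : ℂ)
            = torusSum p N t * torusSum q N t := by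
          push_cast
          linear_combination ((N : ℂ) ^ Fintype.card J * walshCoeff q 0 t) * hP +
            (Complex.I ^ #{e | t e = true} * torusSum p N t) * hQ +
            (torusSum p N t * torusSum q N t : ℂ) * hI
        exact_mod_cast this
      have hnn := mul_nonneg (torusSum_nonneg_of_even p N t hp h1)
        (torusSum_nonneg_of_even q N t hq h2)
      rw [← h] at hnn
      have hpos : (0 : ℝ) < (N : ℝ) ^ Fintype.card I * (N : ℝ) ^ Fintype.card J := by positivity
      exact_mod_cast nonneg_of_mul_nonneg_right hnn hpos
    · push Not at h2
      obtain ⟨j, hj⟩ := h2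
      rw [torusSum_eq_zero_of_odd q N t j (Nat.not_even_iff_odd.1 hj)] at hQ
      have : walshCoeff q 0 t = 0 := by
        have := (mul_eq_zero.1 (hQ.trans (by simp))).resolve_left (pow_ne_zero _ hN0)
        exact_mod_cast this
      simp [this]
  · push Not at h1
    obtain ⟨j, hj⟩ := h1
    rw [torusSum_eq_zero_of_odd p N t j (Nat.not_even_iff_odd.1 hj)] at hP
    have : walshCoeff p 0 t = 0 := by
      have := (mul_eq_zero.1 (hP.trans (by simp))).resolve_left (pow_ne_zero _ hN0)
      exact_mod_cast this
    simp [this]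

/-- Parseval's identity for two sets of colourings. -/
theorem sum_walshCoeff_mul (p : E → I) (q : E → J) :
    ∑ t : E → Bool, walshCoeff p 0 t * walshCoeff q 0 t =
      2 ^ Fintype.card E * #{z : E → Bool | imbalance p z = 0 ∧ imbalance q z = 0} := by
  have horth : ∀ z w : E → Bool, ∑ t : E → Bool, walsh t z * walsh t w =
      if z = w then 2 ^ Fintype.card E else 0 := by
    intro z w
    have : ∀ t : E → Bool, walsh t z * walsh t w =
        ∏ e, ((if t e then sgn (z e) else 1) * (if t e then sgn (w e) else 1)) := fun t => by
      rw [walsh, walsh, prod_mul_distrib]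
    simp_rw [this]
    rw [← Fintype.prod_sum (fun e (b : Bool) =>
      (if b then sgn (z e) else 1) * (if b then sgn (w e) else 1))]
    split_ifs with h
    · subst h
      rw [Fintype.card, ← prod_const]
      refine prod_congr rfl fun e _ => ?_
      rw [Fintype.sum_bool]
      cases z e <;> simp [sgn]
    · obtain ⟨e, he⟩ := Function.ne_iff.1 h
      refine prod_eq_zero (mem_univ e) ?_
      rw [Fintype.sum_bool]
      revert he
      cases z e <;> cases w e <;> simp [sgn]
  simp only [walshCoeff, sum_mul_sum]
  calc _ = ∑ z : E → Bool, ∑ w : E → Bool, ∑ t : E → Bool,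
        (if imbalance p z = 0 ∧ imbalance q w = 0 then walsh t z * walsh t w else 0) := by
        rw [sum_comm]
        refine sum_congr rfl fun z _ => ?_
        rw [sum_comm]
        refine sum_congr rfl fun w _ => sum_congr rfl fun t _ => ?_
        by_cases h1 : imbalance p z = 0 <;> by_cases h2 : imbalance q w = 0 <;> simp [h1, h2]
    _ = ∑ z : E → Bool, ∑ w : E → Bool, (if imbalance p z = 0 ∧ imbalance q w = 0 then
          (if z = w then 2 ^ Fintype.card E else 0) else 0) := by
        refine sum_congr rfl fun z _ => sum_congr rfl fun w _ => ?_
        rw [← horth z w]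
        split_ifs <;> simp
    _ = ∑ z : E → Bool, if imbalance p z = 0 ∧ imbalance q z = 0 then
          2 ^ Fintype.card E else 0 := by
        refine sum_congr rfl fun z _ => ?_
        rw [sum_eq_single z]
        · simp
        · intro w _ hw
          simp [hw.symm]
        · simp
    _ = _ := by
        rw [← sum_filter, sum_const, nsmul_eq_mul, mul_comm]

theorem walshCoeff_false (p : E → I) (s : I → ℤ) :
    walshCoeff p s (fun _ => false) = #{z : E → Bool | imbalance p z = s} := by
  simp [walshCoeff, walsh]

/-- In a bipartite multigraph with even degrees, being balanced at the vertices of one side and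
being balanced at the vertices of the other side are positively correlated. -/
theorem card_balanced_mul_le (p : E → I) (q : E → J) (hp : ∀ i, Even #{e | p e = i})
    (hq : ∀ j, Even #{e | q e = j}) :
    #{z : E → Bool | imbalance p z = 0} * #{z : E → Bool | imbalance q z = 0} ≤
      2 ^ Fintype.card E * #{z : E → Bool | imbalance p z = 0 ∧ imbalance q z = 0} := by
  -- In Parseval's sum only the constant character is kept; its coefficients are the two
  -- cardinalities.
  have h := single_le_sum (f := fun t : E → Bool => walshCoeff p 0 t * walshCoeff q 0 t)
    (fun t _ => walshCoeff_mul_nonneg p q hp hq t) (mem_univ fun _ => false)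
  rw [sum_walshCoeff_mul] at h
  simp only [walshCoeff_false] at h
  exact_mod_cast h

/-- Among all signed degree sequences, zero is attained most often. -/
theorem card_imbalance_le (p : E → I) (hp : ∀ i, Even #{e | p e = i}) (w : E → Bool) :
    #{z : E → Bool | imbalance p z = imbalance p w} ≤ #{z : E → Bool | imbalance p z = 0} := by
  set N := 2 * Fintype.card E + 1 with hN
  have hw := walshCoeff_eq_sum p (imbalance p w) (fun _ => false) N (fun i => by
    have := abs_imbalance_le p w i
    push_cast [hN]
    linarith)
  have h0 := walshCoeff_zero_eq p (fun _ => false) N (by omega)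
  have h0' : (N : ℝ) ^ Fintype.card I * (walshCoeff p 0 fun _ => false : ℤ) =
      torusSum p N fun _ => false := by
    have : ((N : ℂ) ^ Fintype.card I * (walshCoeff p 0 fun _ => false : ℤ)) =
      torusSum p N fun _ => false := by simpa using h0
    exact_mod_cast this
  have hle : (N : ℝ) ^ Fintype.card I * (walshCoeff p (imbalance p w) fun _ => false : ℤ) ≤
      torusSum p N fun _ => false := by
    have h1 := congrArg (fun x : ℂ => ‖x‖) hw
    have hc : ((0 : ℤ) : ℝ) ≤ (walshCoeff p (imbalance p w) fun _ => false : ℤ) := by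
      rw [walshCoeff_false]
      exact_mod_cast Nat.zero_le _
    simp only [norm_mul, norm_pow, Complex.norm_natCast, Complex.norm_intCast] at h1
    rw [abs_of_nonneg (by exact_mod_cast hc)] at h1
    rw [h1]
    -- A nonzero target only inserts unimodular factors; for target zero the summands are already
    -- nonnegative, by evenness of the degrees.
    refine (norm_sum_le _ _).trans (sum_le_sum fun θ _ => ?_)
    have hnn : 0 ≤ ∏ e : E, (if (false : Bool) = true then 2 * (ZMod.stdAddChar (θ (p e))).im
        else 2 * (ZMod.stdAddChar (θ (p e))).re) := by
      rw [prod_torus_eq]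
      refine prod_nonneg fun i _ => ?_
      simpa using (hp i).pow_nonneg _
    rw [norm_mul, norm_prod]
    simp only [AddChar.norm_apply, prod_const_one, one_mul]
    rw [← abs_of_nonneg hnn, ← Real.norm_eq_abs, norm_prod, norm_prod]
    simp
  rw [← h0'] at hle
  have := le_of_mul_le_mul_left hle (by positivity)
  rw [walshCoeff_false, walshCoeff_false] at this
  exact_mod_cast this

/-- Pigeonhole: the vector of positive degrees takes at most `∏ (degree + 1)` values, it determines
the signed degrees, and no class is larger than the balanced one. -/
theorem two_pow_le_card_balanced (p : E → I) (hp : ∀ i, Even #{e | p e = i}) :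
    2 ^ Fintype.card E ≤
      #{z : E → Bool | imbalance p z = 0} * ∏ i, (#{e | p e = i} + 1) := by
  let pos : (E → Bool) → I → ℕ := fun z i => #{e ∈ ({e | p e = i} : Finset E) | z e = true}
  have himb : ∀ z i, imbalance p z i = 2 * pos z i - #{e | p e = i} := by
    intro z i
    have h := card_filter_add_card_filter_not (s := ({e | p e = i} : Finset E))
      (fun e => z e = true)
    simp only [imbalance, ← sum_filter, sgn]
    rw [sum_ite, sum_const, sum_const, ← h]
    simp only [pos, nsmul_eq_mul, mul_one, mul_neg]
    push_cast
    ring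
  have h := card_le_mul_card_image_of_maps_to (f := pos) (s := univ)
    (t := Fintype.piFinset fun i => range (#{e | p e = i} + 1))
    (fun z _ => by
      rw [Fintype.mem_piFinset]
      exact fun i => mem_range.2 (Nat.lt_succ_of_le (card_filter_le _ _)))
    #{z : E → Bool | imbalance p z = 0}
    (fun s _ => by
      rcases ({z ∈ (univ : Finset (E → Bool)) | pos z = s}).eq_empty_or_nonempty with h | ⟨w, hw⟩
      · rw [h]; simp
      · refine le_trans (card_le_card ?_) (card_imbalance_le p hp w)
        intro z hz
        simp only [mem_filter, mem_univ, true_and] at hz hw ⊢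
        funext i
        rw [himb, himb, hz, hw])
  simpa [Fintype.card_piFinset] using h

end Signs

end ZeroOneMargins

/-! ### Splitting arrays in halves: the doubling inequality -/

namespace ZeroOneMargins

open Finset

set_option linter.unusedSectionVars false

section Margins

variable {E I J : Type*} [Fintype E] [DecidableEq E] [Fintype I] [DecidableEq I] [Fintype J]
  [DecidableEq J]

/-- The number of chosen edges at the vertex `i`. -/
def margin (p : E → I) (x : E → Bool) (i : I) : ℕ := ∑ e, if p e = i then (x e).toNat else 0

/-- The number of sets of edges of a bipartite multigraph with prescribed degrees. -/
def marginCount (p : E → I) (q : E → J) (R : I → ℕ) (C : J → ℕ) : ℕ :=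
  #{x : E → Bool | margin p x = R ∧ margin q x = C}

/-- The pointwise sum of two indicator functions. -/
def overlay (w : (E → Bool) × (E → Bool)) (e : E) : ℕ := (w.1 e).toNat + (w.2 e).toNat

theorem overlay_le_two (w : (E → Bool) × (E → Bool)) (e : E) : overlay w e ≤ 2 := by
  unfold overlay
  cases w.1 e <;> cases w.2 e <;> simp

theorem sum_overlay (p : E → I) (w : (E → Bool) × (E → Bool)) (i : I) :
    (∑ e, if p e = i then overlay w e else 0) = margin p w.1 i + margin p w.2 i := by
  rw [margin, margin, ← sum_add_distrib]
  refine sum_congr rfl fun e _ => ?_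
  split_ifs <;> rfl

/-- Edges covered twice contribute an even amount, so the edges covered once carry the parity of the
total. -/
theorem even_degree_of_overlay (p : E → I) (w : (E → Bool) × (E → Bool)) (i : I)
    (h : Even (margin p w.1 i + margin p w.2 i)) :
    Even #{e : {e // overlay w e = 1} | p e = i} := by
  have h1 : #{e : {e // overlay w e = 1} | p e = i} =
      ∑ e with overlay w e = 1, if p e = i then 1 else 0 := by
    rw [card_filter, sum_subtype (p := fun e => overlay w e = 1) _ (by simp)]
  have h2 : (∑ e, if p e = i then overlay w e else 0) =
      #{e : {e // overlay w e = 1} | p e = i} +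
        ∑ e, 2 * if p e = i ∧ overlay w e = 2 then 1 else 0 := by
    rw [h1, sum_filter, ← sum_add_distrib]
    refine sum_congr rfl fun e _ => ?_
    have := overlay_le_two w e
    generalize overlay w e = k at this ⊢
    interval_cases k <;> by_cases hp : p e = i <;> simp [hp]
  rw [← sum_overlay, h2, ← mul_sum, Nat.even_add] at h
  exact h.2 (even_two_mul _)

/-- The pair of edge sets with given overlay `s` that is described by the colouring `z` of the
edges that belong to exactly one of the two sets. -/
def splitOf (s : E → ℕ) (z : {e // s e = 1} → Bool) : (E → Bool) × (E → Bool) :=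
  (fun e => if h : s e = 1 then z ⟨e, h⟩ else decide (s e = 2),
    fun e => if h : s e = 1 then !z ⟨e, h⟩ else decide (s e = 2))

theorem overlay_splitOf (s : E → ℕ) (hs : ∀ e, s e ≤ 2) (z : {e // s e = 1} → Bool) :
    overlay (splitOf s z) = s := by
  funext e
  have := hs e
  by_cases h : s e = 1
  · simp only [overlay, splitOf, h, dif_pos]
    cases z ⟨e, h⟩ <;> simp
  · simp only [overlay, splitOf, h, dif_neg, not_false_eq_true]
    have : s e = 0 ∨ s e = 2 := by omega
    rcases this with h | h <;> simp [h]

theorem margin_splitOf_sub (p : E → I) (s : E → ℕ) (z : {e // s e = 1} → Bool) (i : I) :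
    (margin p (splitOf s z).1 i : ℤ) - margin p (splitOf s z).2 i =
      imbalance (fun e : {e // s e = 1} => p e) z i := by
  have h1 : imbalance (fun e : {e // s e = 1} => p e) z i =
      ∑ e : {e // s e = 1}, (fun e : E => if p e = i then
        (if h : s e = 1 then sgn (z ⟨e, h⟩) else 0) else 0) e := by
    refine sum_congr rfl fun e _ => ?_
    simp [e.2]
  rw [h1, ← sum_subtype (p := fun e => s e = 1) (univ.filter fun e => s e = 1) (by simp)
    (fun e : E => if p e = i then (if h : s e = 1 then sgn (z ⟨e, h⟩) else 0) else 0),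
    sum_filter, margin, margin, Nat.cast_sum, Nat.cast_sum, ← sum_sub_distrib]
  refine sum_congr rfl fun e _ => ?_
  by_cases hp : p e = i
  · by_cases h : s e = 1
    · simp only [splitOf, hp, h, dif_pos, if_true]
      cases z ⟨e, h⟩ <;> simp [sgn]
    · simp [splitOf, hp, h]
  · simp [hp]

/-- Within one overlay class, pairs inject into colourings of the edges covered once, and the
colourings balanced on both sides inject into pairs with margins exactly `R` and `C`. The
correlation inequality and the bounds for each side compare the two numbers. -/
theorem card_split_le (p : E → I) (q : E → J) (R : I → ℕ) (C : J → ℕ)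
    (w : (E → Bool) × (E → Bool))
    (hR : ∀ i, margin p w.1 i + margin p w.2 i = 2 * R i)
    (hC : ∀ j, margin q w.1 j + margin q w.2 j = 2 * C j) :
    #{v : (E → Bool) × (E → Bool) | overlay v = overlay w} ≤
      #{v : (E → Bool) × (E → Bool) | ((margin p v.1 = R ∧ margin q v.1 = C) ∧
        (margin p v.2 = R ∧ margin q v.2 = C)) ∧ overlay v = overlay w} *
      ((∏ i, (#{e | p e = i} + 1)) * ∏ j, (#{e | q e = j} + 1)) := by
  set s := overlay w with hs
  have hs2 : ∀ e, s e ≤ 2 := overlay_le_two w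
  have hsR : ∀ i, (∑ e, if p e = i then s e else 0) = 2 * R i := fun i => by
    rw [hs, sum_overlay, hR]
  have hsC : ∀ j, (∑ e, if q e = j then s e else 0) = 2 * C j := fun j => by
    rw [hs, sum_overlay, hC]
  let p' : {e // s e = 1} → I := fun e => p e
  let q' : {e // s e = 1} → J := fun e => q e
  have hp' : ∀ i, Even #{e | p' e = i} := fun i =>
    even_degree_of_overlay p w i (by rw [hR]; exact even_two_mul _)
  have hq' : ∀ j, Even #{e | q' e = j} := fun j =>
    even_degree_of_overlay q w j (by rw [hC]; exact even_two_mul _)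
  have hup : #{v : (E → Bool) × (E → Bool) | overlay v = s} ≤
      2 ^ Fintype.card {e // s e = 1} := by
    have h := card_le_card_of_injOn (s := ({v | overlay v = s} : Finset ((E → Bool) × (E → Bool))))
      (t := (univ : Finset ({e // s e = 1} → Bool))) (fun v e => v.1 e) (by simp) (by
        intro v hv u hu h
        simp only [coe_filter, mem_univ, true_and, Set.mem_ofPred_eq] at hv hu
        have key : ∀ e, v.1 e = u.1 e ∧ v.2 e = u.2 e := by
          intro e
          have h1 : overlay v e = s e := congrFun hv e
          have h2 : overlay u e = s e := congrFun hu e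
          have h3 : s e = 1 → v.1 e = u.1 e := fun he => congrFun h ⟨e, he⟩
          unfold overlay at h1 h2
          revert h1 h2 h3
          generalize s e = k
          cases v.1 e <;> cases v.2 e <;> cases u.1 e <;> cases u.2 e <;> simp <;> omega
        exact Prod.ext (funext fun e => (key e).1) (funext fun e => (key e).2))
    simpa using h
  have hlow : #{z : {e // s e = 1} → Bool | imbalance p' z = 0 ∧ imbalance q' z = 0} ≤
      #{v : (E → Bool) × (E → Bool) | ((margin p v.1 = R ∧ margin q v.1 = C) ∧
        (margin p v.2 = R ∧ margin q v.2 = C)) ∧ overlay v = s} := by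
    refine card_le_card_of_injOn (splitOf s) ?_ ?_
    · intro z hz
      simp only [coe_filter, mem_univ, true_and, Set.mem_ofPred_eq] at hz ⊢
      have ho := overlay_splitOf s hs2 z
      have hr : ∀ i, margin p (splitOf s z).1 i = R i ∧ margin p (splitOf s z).2 i = R i := by
        intro i
        have h1 := margin_splitOf_sub p s z i
        have h2 := sum_overlay p (splitOf s z) i
        rw [ho, hsR] at h2
        have h3 : imbalance p' z i = 0 := congrFun hz.1 i
        change _ = imbalance p' z i at h1
        omega
      have hc : ∀ i, margin q (splitOf s z).1 i = C i ∧ margin q (splitOf s z).2 i = C i := by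
        intro i
        have h1 := margin_splitOf_sub q s z i
        have h2 := sum_overlay q (splitOf s z) i
        rw [ho, hsC] at h2
        have h3 : imbalance q' z i = 0 := congrFun hz.2 i
        change _ = imbalance q' z i at h1
        omega
      exact ⟨⟨⟨funext fun i => (hr i).1, funext fun i => (hc i).1⟩,
        ⟨funext fun i => (hr i).2, funext fun i => (hc i).2⟩⟩, ho⟩
    · intro z _ z' _ h
      funext e
      have h1 : (splitOf s z).1 e = (splitOf s z').1 e := by rw [h]
      simpa [splitOf, e.2] using h1
  have hdp : ∏ i, (#{e | p' e = i} + 1) ≤ ∏ i, (#{e | p e = i} + 1) := by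
    refine prod_le_prod' fun i _ => Nat.succ_le_succ ?_
    exact card_le_card_of_injOn Subtype.val (by intro e he; simpa [p'] using he)
      Subtype.val_injective.injOn
  have hdq : ∏ i, (#{e | q' e = i} + 1) ≤ ∏ i, (#{e | q e = i} + 1) := by
    refine prod_le_prod' fun i _ => Nat.succ_le_succ ?_
    exact card_le_card_of_injOn Subtype.val (by intro e he; simpa [q'] using he)
      Subtype.val_injective.injOn
  have hcor := card_balanced_mul_le p' q' hp' hq'
  have hbp := two_pow_le_card_balanced p' hp'
  have hbq := two_pow_le_card_balanced q' hq'
  refine hup.trans ?_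
  refine le_trans ?_ (Nat.mul_le_mul hlow (Nat.mul_le_mul hdp hdq))
  refine Nat.le_of_mul_le_mul_left (c := 2 ^ Fintype.card {e // s e = 1}) ?_ (Nat.two_pow_pos _)
  calc _ ≤ _ := Nat.mul_le_mul hbp hbq
    _ = (#{z | imbalance p' z = 0} * #{z | imbalance q' z = 0}) *
        ((∏ i, (#{e | p' e = i} + 1)) * ∏ j, (#{e | q' e = j} + 1)) := by ring
    _ ≤ _ := Nat.mul_le_mul_right _ hcor
    _ = _ := by ring

/-- The bound of `card_split_le` is summed over all overlays. -/
theorem card_pairs_le (p : E → I) (q : E → J) (R : I → ℕ) (C : J → ℕ) :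
    #{w : (E → Bool) × (E → Bool) | (∀ i, margin p w.1 i + margin p w.2 i = 2 * R i) ∧
        ∀ j, margin q w.1 j + margin q w.2 j = 2 * C j} ≤
      marginCount p q R C ^ 2 *
        ((∏ i, (#{e | p e = i} + 1)) * ∏ j, (#{e | q e = j} + 1)) := by
  set A : Finset ((E → Bool) × (E → Bool)) :=
    {w | (∀ i, margin p w.1 i + margin p w.2 i = 2 * R i) ∧
        ∀ j, margin q w.1 j + margin q w.2 j = 2 * C j} with hA
  set B : Finset ((E → Bool) × (E → Bool)) :=
    {v | (margin p v.1 = R ∧ margin q v.1 = C) ∧ (margin p v.2 = R ∧ margin q v.2 = C)} with hB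
  have hBcard : #B = marginCount p q R C ^ 2 := by
    rw [marginCount, sq, ← card_product]
    congr 1
    ext v
    simp [hB]
  have hBA : B ⊆ A := by
    intro v hv
    simp only [hB, hA, mem_filter, mem_univ, true_and] at hv ⊢
    rw [hv.1.1, hv.1.2, hv.2.1, hv.2.2]
    exact ⟨fun i => (two_mul _).symm, fun i => (two_mul _).symm⟩
  rw [← hBcard, card_eq_sum_card_image overlay A,
    card_eq_sum_card_fiberwise (f := overlay) (s := B) (t := A.image overlay)
      (fun v hv => mem_image_of_mem _ (hBA hv)), sum_mul]
  refine sum_le_sum fun s hs => ?_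
  obtain ⟨w, hw, rfl⟩ := mem_image.1 hs
  simp only [hA, mem_filter, mem_univ, true_and] at hw
  refine (card_le_card (filter_subset_filter _ (subset_univ A))).trans ?_
  refine (card_split_le p q R C w hw.1 hw.2).trans ?_
  rw [hB, filter_filter]

theorem margin_prod_fin (p : E → I) (K : ℕ) (x : E × Fin K → Bool) (i : I) :
    margin (fun e : E × Fin K => p e.1) x i =
      ∑ e, if p e = i then ∑ k, (x (e, k)).toNat else 0 := by
  rw [margin, Fintype.sum_prod_type]
  refine sum_congr rfl fun e _ => ?_
  split_ifs <;> simp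

theorem margin_castAdd_add_natAdd (p : E → I) (K : ℕ) (x : E × Fin (K + K) → Bool) (i : I) :
    margin (fun e : E × Fin K => p e.1) (fun e => x (e.1, Fin.castAdd K e.2)) i +
      margin (fun e : E × Fin K => p e.1) (fun e => x (e.1, Fin.natAdd K e.2)) i =
    margin (fun e : E × Fin (K + K) => p e.1) x i := by
  rw [margin_prod_fin, margin_prod_fin, margin_prod_fin, ← sum_add_distrib]
  refine sum_congr rfl fun e _ => ?_
  split_ifs
  · rw [Fin.sum_univ_add]
  · rfl

theorem degree_prod_fin (p : E → I) (K : ℕ) (i : I) :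
    #{e : E × Fin K | p e.1 = i} = #{e | p e = i} * K := by
  have : ({e : E × Fin K | p e.1 = i} : Finset _) = ({e | p e = i} : Finset E) ×ˢ univ := by
    ext; simp
  rw [this, card_product, card_univ, Fintype.card_fin]

/-- The number of sets of edges of the `K`-fold blow-up with `K`-fold degrees. -/
def blowupCount (p : E → I) (q : E → J) (R : I → ℕ) (C : J → ℕ) (K : ℕ) : ℕ :=
  marginCount (fun e : E × Fin K => p e.1) (fun e : E × Fin K => q e.1)
    (fun i => K * R i) fun j => K * C j

theorem blowupCount_two_mul_le (p : E → I) (q : E → J) (R : I → ℕ) (C : J → ℕ) (K : ℕ) :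
    blowupCount p q R C (K + K) ≤ blowupCount p q R C K ^ 2 *
      ((∏ i, (#{e | p e = i} * K + 1)) * ∏ j, (#{e | q e = j} * K + 1)) := by
  have h := card_pairs_le (fun e : E × Fin K => p e.1) (fun e : E × Fin K => q e.1)
    (fun i => K * R i) fun j => K * C j
  simp only [degree_prod_fin] at h
  refine le_trans ?_ h
  refine card_le_card_of_injOn
    (fun x => (fun e => x (e.1, Fin.castAdd K e.2), fun e => x (e.1, Fin.natAdd K e.2))) ?_ ?_
  · intro x hx
    simp only [coe_filter, mem_univ, true_and, Set.mem_ofPred_eq] at hx ⊢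
    refine ⟨fun i => ?_, fun j => ?_⟩
    · rw [margin_castAdd_add_natAdd, hx.1]; ring
    · rw [margin_castAdd_add_natAdd, hx.2]; ring
  · intro x _ y _ h
    funext ⟨e, k⟩
    rw [Prod.mk.injEq] at h
    refine Fin.addCases (fun k => ?_) (fun k => ?_) k
    · exact congrFun h.1 (e, k)
    · exact congrFun h.2 (e, k)

end Margins

end ZeroOneMargins

/-! ### Binomial lower bounds and integer approximation -/

namespace ZeroOneMargins

open Finset

set_option linter.unusedSectionVars false

section Blowup

variable {E I J : Type*} [Fintype E] [DecidableEq E] [Fintype I] [DecidableEq I] [Fintype J]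
  [DecidableEq J]

/-- Choosing, independently for each edge `e`, which `M e` of its `K` copies to take always gives
the required margins. -/
theorem prod_choose_le_blowupCount (p : E → I) (q : E → J) (R : I → ℕ) (C : J → ℕ) (K : ℕ)
    (M : E → ℕ) (hR : ∀ i, (∑ e, if p e = i then M e else 0) = K * R i)
    (hC : ∀ j, (∑ e, if q e = j then M e else 0) = K * C j) :
    ∏ e, K.choose (M e) ≤ blowupCount p q R C K := by
  have h1 : ∏ e, K.choose (M e) =
      #(Fintype.piFinset fun e => powersetCard (M e) (univ : Finset (Fin K))) := by
    simp [Fintype.card_piFinset, card_powersetCard]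
  rw [h1]
  refine card_le_card_of_injOn (fun f e => decide (e.2 ∈ f e.1)) ?_ ?_
  · intro f hf
    rw [mem_coe, Fintype.mem_piFinset] at hf
    have hs : ∀ e, ∑ k, (decide (k ∈ f e)).toNat = M e := by
      intro e
      rw [← (mem_powersetCard.1 (hf e)).2]
      simp [Bool.toNat, Bool.cond_decide]
    simp only [coe_filter, mem_univ, true_and, Set.mem_ofPred_eq]
    refine ⟨funext fun i => ?_, funext fun j => ?_⟩
    · rw [margin_prod_fin, ← hR i]
      simp only [hs]
    · rw [margin_prod_fin, ← hC j]
      simp only [hs]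
  · intro f _ g _ h
    funext e
    ext k
    have := congrFun h (e, k)
    simpa using this

end Blowup

/-- The sequence `a ^ l / l!` is largest at `l = a`. -/
theorem pow_mul_factorial_le (a l : ℕ) : a ^ l * a.factorial ≤ a ^ a * l.factorial := by
  rcases le_total a l with h | h
  · have h1 := Nat.factorial_mul_pow_sub_le_factorial h
    calc a ^ l * a.factorial = a ^ a * (a.factorial * a ^ (l - a)) := by
          rw [← Nat.add_sub_cancel' h, pow_add]; simp; ring
      _ ≤ _ := Nat.mul_le_mul_left _ h1
  · have h1 := Nat.factorial_mul_descFactorial (Nat.sub_le a l)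
    rw [Nat.sub_sub_self h] at h1
    calc a ^ l * a.factorial = a ^ l * a.descFactorial (a - l) * l.factorial := by
          rw [← h1]; ring
      _ ≤ a ^ l * a ^ (a - l) * l.factorial :=
          Nat.mul_le_mul_right _ (Nat.mul_le_mul_left _ (Nat.descFactorial_le_pow _ _))
      _ = _ := by rw [← pow_add, Nat.add_sub_cancel' h]

/-- Of the `a + b + 1` terms in the binomial expansion, the one with `l = a` is the largest. -/
theorem add_pow_le_choose (a b : ℕ) :
    (a + b) ^ (a + b) ≤ (a + b + 1) * ((a + b).choose a * (a ^ a * b ^ b)) := by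
  rw [add_pow]
  have : ∀ l ∈ range (a + b + 1), a ^ l * b ^ (a + b - l) * (a + b).choose l ≤
      (a + b).choose a * (a ^ a * b ^ b) := by
    intro l hl
    obtain ⟨r, hr⟩ := Nat.exists_eq_add_of_le (Nat.lt_succ_iff.1 (mem_range.1 hl))
    rw [hr, Nat.add_sub_cancel_left, ← hr]
    have h1 := Nat.choose_mul_factorial_mul_factorial (Nat.le_add_right a b)
    have h2 := Nat.choose_mul_factorial_mul_factorial (Nat.le_add_right l r)
    rw [Nat.add_sub_cancel_left] at h1 h2
    rw [← hr] at h2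
    have h3 := Nat.mul_le_mul (pow_mul_factorial_le a l) (pow_mul_factorial_le b r)
    have hpos : 0 < (a.factorial * b.factorial) * (l.factorial * r.factorial) := by positivity
    refine Nat.le_of_mul_le_mul_right (c := (a.factorial * b.factorial) *
      (l.factorial * r.factorial)) ?_ hpos
    calc _ = (a ^ l * a.factorial * (b ^ r * b.factorial)) *
          ((a + b).choose l * l.factorial * r.factorial) := by ring
      _ ≤ a ^ a * l.factorial * (b ^ b * r.factorial) *
          ((a + b).choose a * a.factorial * b.factorial) :=
          Nat.mul_le_mul h3 (h2.trans h1.symm).le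
      _ = _ := by ring
  refine (sum_le_sum this).trans ?_
  simp

theorem binEntropy_le_log_choose {K M : ℕ} (hK : 0 < K) (hM : M ≤ K) :
    K * Real.binEntropy (M / K) ≤ Real.log (K + 1) + Real.log (K.choose M) := by
  obtain ⟨b, rfl⟩ := Nat.exists_eq_add_of_le hM
  have hK' : (0 : ℝ) < ((M + b : ℕ) : ℝ) := by exact_mod_cast hK
  have h := add_pow_le_choose M b
  have hself : ∀ c : ℕ, (0 : ℝ) < (c : ℝ) ^ c := by
    intro c
    rcases c.eq_zero_or_pos with h | h
    · simp [h]
    · positivity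
  have hch : (0 : ℝ) < ((M + b).choose M : ℕ) := by exact_mod_cast Nat.choose_pos hM
  have h' : (((M + b : ℕ) : ℝ)) ^ (M + b) ≤ (((M + b : ℕ) : ℝ) + 1) *
      (((M + b).choose M : ℕ) * ((M : ℝ) ^ M * (b : ℝ) ^ b)) := by exact_mod_cast h
  have hl := Real.log_le_log (hself (M + b)) h'
  rw [Real.log_mul (by positivity) (mul_pos hch (mul_pos (hself _) (hself _))).ne',
    Real.log_mul hch.ne' (mul_pos (hself _) (hself _)).ne',
    Real.log_mul (hself _).ne' (hself _).ne', Real.log_pow, Real.log_pow, Real.log_pow] at hl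
  have hdiv : ∀ c : ℕ, ((M + b : ℕ) : ℝ) * Real.negMulLog ((c : ℝ) / ((M + b : ℕ) : ℝ)) =
      c * Real.log ((M + b : ℕ) : ℝ) - c * Real.log c := by
    intro c
    rcases c.eq_zero_or_pos with h | h
    · simp [h]
    · rw [Real.negMulLog, Real.log_div (by positivity) hK'.ne']
      field_simp
      ring
  have h1 : 1 - (M : ℝ) / ((M + b : ℕ) : ℝ) = (b : ℝ) / ((M + b : ℕ) : ℝ) := by
    field_simp
    push_cast
    ring
  rw [Real.binEntropy_eq_negMulLog_add_negMulLog_one_sub, mul_add, h1, hdiv, hdiv]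
  have : ((M + b : ℕ) : ℝ) = M + b := by push_cast; ring
  rw [this] at hl ⊢
  linarith

/-- Attach `a i` stubs to row `i` and `b j` stubs to column `j`, match them by any bijection and
count matches. -/
theorem exists_nat_matrix {m n : ℕ} (a : Fin m → ℕ) (b : Fin n → ℕ)
    (h : ∑ i, a i = ∑ j, b j) :
    ∃ N : Fin m → Fin n → ℕ, (∀ i, ∑ j, N i j = a i) ∧ ∀ j, ∑ i, N i j = b j := by
  have hc : Fintype.card (Σ i, Fin (a i)) = Fintype.card (Σ j, Fin (b j)) := by
    simpa [Fintype.card_sigma] using h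
  let e := Fintype.equivOfCardEq hc
  have hfib : ∀ {l : ℕ} (c : Fin l → ℕ) (i : Fin l),
      #{x : Σ i, Fin (c i) | x.1 = i} = c i := by
    intro l c i
    rw [← Fintype.card_fin (c i), ← card_univ]
    symm
    refine card_bij (fun k _ => ⟨i, k⟩) (by simp) (by simp) ?_
    rintro ⟨i', k⟩ hx
    simp only [mem_filter, mem_univ, true_and] at hx
    subst hx
    exact ⟨k, mem_univ _, rfl⟩
  refine ⟨fun i j => #{x : Σ i, Fin (a i) | x.1 = i ∧ (e x).1 = j}, fun i => ?_, fun j => ?_⟩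
  · rw [← hfib a i, card_eq_sum_card_fiberwise (f := fun x => (e x).1) (t := univ)
      (by simp [Set.MapsTo])]
    simp only [filter_filter]
  · have : #{x : Σ i, Fin (a i) | (e x).1 = j} = b j := by
      rw [← hfib b j]
      exact card_bij (fun x _ => e x) (by simp) (fun x _ y _ h => e.injective h)
        (fun y hy => ⟨e.symm y, by simpa using hy, by simp⟩)
    rw [← this, card_eq_sum_card_fiberwise (f := fun x : Σ i, Fin (a i) => x.1) (t := univ)
      (by simp [Set.MapsTo])]
    simp only [filter_filter, and_comm]

/-- Integer matrices with `K`-fold margins close to `K • Z`. -/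
theorem exists_nat_matrix_near {m n : ℕ} {R : Fin m → ℕ} {C : Fin n → ℕ}
    {Z : Matrix (Fin m) (Fin n) ℝ} (hZ : Z ∈ polytope R C) (K : ℕ) :
    ∃ M : Fin m → Fin n → ℕ, (∀ i, ∑ j, M i j = K * R i) ∧ (∀ j, ∑ i, M i j = K * C j) ∧
      ∀ i j, K * Z i j - 1 ≤ M i j ∧ (M i j : ℝ) ≤ K * Z i j + n := by
  have hnn : ∀ i j, 0 ≤ K * Z i j := fun i j => mul_nonneg (Nat.cast_nonneg _) (hZ.2.2 i j).1
  have hfl : ∀ i j, (⌊K * Z i j⌋₊ : ℝ) ≤ K * Z i j := fun i j => Nat.floor_le (hnn i j)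
  have hrow : ∀ i, ∑ j, ⌊K * Z i j⌋₊ ≤ K * R i := by
    intro i
    have : ((∑ j, ⌊K * Z i j⌋₊ : ℕ) : ℝ) ≤ (K * R i : ℕ) := by
      push_cast
      rw [← hZ.1 i, mul_sum]
      exact sum_le_sum fun j _ => hfl i j
    exact_mod_cast this
  have hcol : ∀ j, ∑ i, ⌊K * Z i j⌋₊ ≤ K * C j := by
    intro j
    have : ((∑ i, ⌊K * Z i j⌋₊ : ℕ) : ℝ) ≤ (K * C j : ℕ) := by
      push_cast
      rw [← hZ.2.1 j, mul_sum]
      exact sum_le_sum fun i _ => hfl i j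
    exact_mod_cast this
  have hRC : ∑ i, K * R i = ∑ j, K * C j := by
    have : ∑ i, (R i : ℝ) = ∑ j, (C j : ℝ) := by
      simp_rw [← hZ.1, ← hZ.2.1]
      exact sum_comm
    rw [← mul_sum, ← mul_sum]
    congr 1
    exact_mod_cast this
  -- The deficits left by rounding down are redistributed; a row deficit is at most `n`, which
  -- bounds each correction independently of `K`.
  obtain ⟨N, hN1, hN2⟩ := exists_nat_matrix (fun i => K * R i - ∑ j, ⌊K * Z i j⌋₊)
    (fun j => K * C j - ∑ i, ⌊K * Z i j⌋₊) (by
      rw [sum_tsub_distrib _ fun i _ => hrow i, sum_tsub_distrib _ fun j _ => hcol j, hRC,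
        sum_comm])
  refine ⟨fun i j => ⌊K * Z i j⌋₊ + N i j, fun i => ?_, fun j => ?_, fun i j => ⟨?_, ?_⟩⟩
  · rw [sum_add_distrib, hN1, Nat.add_sub_cancel' (hrow i)]
  · rw [sum_add_distrib, hN2, Nat.add_sub_cancel' (hcol j)]
  · have := Nat.lt_floor_add_one (K * Z i j)
    push_cast
    have h0 : (0 : ℝ) ≤ N i j := Nat.cast_nonneg _
    linarith
  · have h1 : N i j ≤ K * R i - ∑ j, ⌊K * Z i j⌋₊ := by
      rw [← hN1 i]
      exact single_le_sum (f := fun j => N i j) (fun _ _ => Nat.zero_le _) (mem_univ j)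
    have h2 : (N i j : ℝ) ≤ (K * R i : ℕ) - (∑ j, ⌊K * Z i j⌋₊ : ℕ) := by
      rw [← Nat.cast_sub (hrow i)]
      exact_mod_cast h1
    have h3 : ((K * R i : ℕ) : ℝ) - (∑ j, ⌊K * Z i j⌋₊ : ℕ) ≤ n := by
      push_cast
      rw [← hZ.1 i, mul_sum, ← sum_sub_distrib]
      calc _ ≤ ∑ _j : Fin n, (1 : ℝ) := sum_le_sum fun j _ => by
            have := Nat.lt_floor_add_one (K * Z i j)
            linarith
        _ = n := by simp
    push_cast
    linarith [hfl i j]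

end ZeroOneMargins

/-! ### The lower bound for the number of 0-1 matrices -/

namespace ZeroOneMargins

open Finset Filter Topology

section Count

variable {m n : ℕ}

/-- `blowupCount` for the complete bipartite graph. -/
def gridCount (R : Fin m → ℕ) (C : Fin n → ℕ) (K : ℕ) : ℕ :=
  blowupCount (Prod.fst : Fin m × Fin n → Fin m) Prod.snd R C K

theorem gridCount_two_mul_le (R : Fin m → ℕ) (C : Fin n → ℕ) (K : ℕ) :
    gridCount R C (K + K) ≤ gridCount R C K ^ 2 * ((n * K + 1) ^ m * (m * K + 1) ^ n) := by
  have h1 : ∀ i : Fin m, #{e : Fin m × Fin n | e.1 = i} = n := by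
    intro i
    have : ({e : Fin m × Fin n | e.1 = i} : Finset _) = {i} ×ˢ univ := by ext ⟨a, b⟩; simp [eq_comm]
    rw [this, card_product]; simp
  have h2 : ∀ j : Fin n, #{e : Fin m × Fin n | e.2 = j} = m := by
    intro j
    have : ({e : Fin m × Fin n | e.2 = j} : Finset _) = univ ×ˢ {j} := by ext ⟨a, b⟩; simp [eq_comm]
    rw [this, card_product]; simp
  have h := blowupCount_two_mul_le (Prod.fst : Fin m × Fin n → Fin m) Prod.snd R C K
  simp only [h1, h2, prod_const, card_univ, Fintype.card_fin] at h
  exact h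

/-- The doubling inequality also carries positivity downwards, which is how 0-1 matrices with these
margins are shown to exist. -/
theorem gridCount_pos_of_pow (R : Fin m → ℕ) (C : Fin n → ℕ) (k : ℕ)
    (h : 0 < gridCount R C (2 ^ k)) : 0 < gridCount R C 1 := by
  induction k with
  | zero => simpa using h
  | succ k ih =>
    refine ih (Nat.pos_of_ne_zero fun h0 => ?_)
    have := gridCount_two_mul_le R C (2 ^ k)
    rw [h0, ← two_mul, ← pow_succ'] at this
    simp at this
    omega

/-- The error terms solve `f (k + 1) = 2 * f k + c + d * k` with `f 0 = 0`, namely `f k = c * (2 ^ k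
- 1) + d * (2 ^ k - k - 1)`. -/
theorem log_gridCount_le (hm : 0 < m) (hn : 0 < n) (R : Fin m → ℕ) (C : Fin n → ℕ) (k : ℕ)
    (h : 0 < gridCount R C (2 ^ k)) :
    Real.log (gridCount R C (2 ^ k)) ≤ 2 ^ k * Real.log (gridCount R C 1) +
      (m * Real.log (2 * n) + n * Real.log (2 * m)) * (2 ^ k - 1) +
      (m + n) * Real.log 2 * (2 ^ k - k - 1) := by
  induction k with
  | zero => simp
  | succ k ih =>
    have h2 := gridCount_two_mul_le R C (2 ^ k)
    rw [← two_mul, ← pow_succ'] at h2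
    have hpos : 0 < gridCount R C (2 ^ k) := by
      refine Nat.pos_of_ne_zero fun h0 => ?_
      rw [h0] at h2
      simp at h2
      omega
    have hpos' : (0 : ℝ) < gridCount R C (2 ^ k) := by exact_mod_cast hpos
    have h3 : (gridCount R C (2 ^ (k + 1)) : ℝ) ≤ (gridCount R C (2 ^ k) : ℝ) ^ 2 *
        ((n * 2 ^ k + 1) ^ m * (m * 2 ^ k + 1) ^ n) := by exact_mod_cast h2
    have h4 := Real.log_le_log (by exact_mod_cast h) h3
    rw [Real.log_mul (by positivity) (by positivity), Real.log_mul (by positivity) (by positivity),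
      Real.log_pow, Real.log_pow, Real.log_pow] at h4
    have hb : ∀ c : ℕ, 0 < c →
        Real.log (c * 2 ^ k + 1) ≤ Real.log (2 * c) + k * Real.log 2 := by
      intro c hc
      have hc' : (1 : ℝ) ≤ c := by exact_mod_cast hc
      have h2k : (1 : ℝ) ≤ 2 ^ k := one_le_pow₀ (by norm_num)
      rw [← Real.log_pow, ← Real.log_mul (by positivity) (by positivity)]
      refine Real.log_le_log (by positivity) ?_
      nlinarith
    have h5 := mul_le_mul_of_nonneg_left (hb n hn) (Nat.cast_nonneg (α := ℝ) m)
    have h6 := mul_le_mul_of_nonneg_left (hb m hm) (Nat.cast_nonneg (α := ℝ) n)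
    have h7 := ih hpos
    push_cast at h4 ⊢
    rw [pow_succ (2 : ℝ)]
    linarith

/-- The matrix with entries `0` and `1` given by a set of cells of the grid. -/
def toMatrix (x : (Fin m × Fin n) × Fin 1 → Bool) : Matrix (Fin m) (Fin n) ℝ :=
  fun i j => ((x ((i, j), 0)).toNat : ℝ)

theorem margin_fst_eq (x : (Fin m × Fin n) × Fin 1 → Bool) (i : Fin m) :
    margin (fun e : (Fin m × Fin n) × Fin 1 => e.1.1) x i = ∑ j, (x ((i, j), 0)).toNat := by
  rw [margin_prod_fin (Prod.fst : Fin m × Fin n → Fin m), Fintype.sum_prod_type,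
    sum_eq_single i]
  · simp
  · intro i' _ h
    simp [h]
  · simp

theorem margin_snd_eq (x : (Fin m × Fin n) × Fin 1 → Bool) (j : Fin n) :
    margin (fun e : (Fin m × Fin n) × Fin 1 => e.1.2) x j = ∑ i, (x ((i, j), 0)).toNat := by
  rw [margin_prod_fin (Prod.snd : Fin m × Fin n → Fin n), Fintype.sum_prod_type]
  refine sum_congr rfl fun i _ => ?_
  simp

theorem gridCount_one_le (R : Fin m → ℕ) (C : Fin n → ℕ) :
    gridCount R C 1 ≤ (zeroOneMatrices R C).ncard := by
  rw [gridCount, blowupCount, marginCount, ← Set.ncard_coe_finset]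
  refine Set.ncard_le_ncard_of_injOn toMatrix ?_ ?_ (finite_zeroOneMatrices R C)
  · intro x hx
    simp only [coe_filter, mem_univ, true_and, Set.mem_ofPred_eq, one_mul] at hx
    refine ⟨fun i => ?_, fun j => ?_, fun i j => ?_⟩
    · have h : R i = ∑ j, (x ((i, j), 0)).toNat := by rw [← margin_fst_eq x i, hx.1]
      rw [h]
      simp [toMatrix]
    · have h : C j = ∑ i, (x ((i, j), 0)).toNat := by rw [← margin_snd_eq x j, hx.2]
      rw [h]
      simp [toMatrix]
    · unfold toMatrix
      cases x ((i, j), 0) <;> simp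
  · intro x _ y _ h
    funext ⟨⟨i, j⟩, k⟩
    obtain rfl : k = 0 := Subsingleton.elim _ _
    have h1 : toMatrix x i j = toMatrix y i j := by rw [h]
    unfold toMatrix at h1
    revert h1
    cases x ((i, j), 0) <;> cases y ((i, j), 0) <;> simp

theorem sum_binEntropy_le_log_gridCount {R : Fin m → ℕ} {C : Fin n → ℕ} {K : ℕ} (hK : 0 < K)
    (M : Fin m → Fin n → ℕ) (hR : ∀ i, ∑ j, M i j = K * R i) (hC : ∀ j, ∑ i, M i j = K * C j)
    (hM : ∀ i j, M i j ≤ K) :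
    0 < gridCount R C K ∧
      K * (∑ i, ∑ j, Real.binEntropy (M i j / K)) ≤
        m * n * Real.log (K + 1) + Real.log (gridCount R C K) := by
  have h := prod_choose_le_blowupCount (Prod.fst : Fin m × Fin n → Fin m) Prod.snd R C K
    (fun e => M e.1 e.2)
    (fun i => by
      rw [Fintype.sum_prod_type, sum_eq_single i, ← hR i]
      · simp
      · intro i' _ hi
        simp [hi]
      · simp)
    (fun j => by
      rw [Fintype.sum_prod_type, ← hC j]
      refine sum_congr rfl fun i _ => ?_
      simp)
  rw [Fintype.prod_prod_type] at h
  have hpos : ∀ i j, 0 < K.choose (M i j) := fun i j => Nat.choose_pos (hM i j)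
  have hpos' : ∀ i j, (0 : ℝ) < K.choose (M i j) := fun i j => by exact_mod_cast hpos i j
  refine ⟨lt_of_lt_of_le (prod_pos fun i _ => prod_pos fun j _ => hpos i j) h, ?_⟩
  have h' : (∏ i, ∏ j, (K.choose (M i j) : ℝ)) ≤ gridCount R C K := by exact_mod_cast h
  have hl := Real.log_le_log (prod_pos fun i _ => prod_pos fun j _ => hpos' i j) h'
  rw [Real.log_prod fun i _ => (prod_pos fun j _ => hpos' i j).ne'] at hl
  simp_rw [Real.log_prod fun j _ => (hpos' _ j).ne'] at hl
  have hs : (∑ i : Fin m, ∑ j : Fin n, K * Real.binEntropy (M i j / K)) ≤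
      ∑ i, ∑ j, (Real.log (K + 1) + Real.log (K.choose (M i j))) :=
    sum_le_sum fun i _ => sum_le_sum fun j _ => binEntropy_le_log_choose hK (hM i j)
  simp_rw [sum_add_distrib, ← mul_sum] at hs
  simp only [sum_const, card_univ, Fintype.card_fin, nsmul_eq_mul] at hs
  rw [← mul_assoc] at hs
  linarith

/-- The number of 0-1 matrices is at least `exp (h(Z))` up to a factor `(4 n) ^ (2 n)`. -/
theorem entropy_le_log_ncard {R : Fin m → ℕ} {C : Fin n → ℕ} {Z : Matrix (Fin m) (Fin n) ℝ}
    (hm : 0 < m) (hmn : m ≤ n) (hZ : Z ∈ polytope R C) (hZ1 : ∀ i j, Z i j < 1) :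
    0 < (zeroOneMatrices R C).ncard ∧
      entropy Z ≤ Real.log ((zeroOneMatrices R C).ncard) + 2 * n * Real.log (4 * n) := by
  have hn : 0 < n := hm.trans_le hmn
  choose M hMR hMC hM using fun K => exists_nat_matrix_near hZ K
  have hpow : Tendsto (fun k : ℕ => (2 : ℝ) ^ k) atTop atTop :=
    tendsto_pow_atTop_atTop_of_one_lt (by norm_num)
  -- Here `Z i j < 1` matters: the gap `2 ^ k * (1 - Z i j)` eventually absorbs the rounding error
  -- `n`.
  have hev : ∀ᶠ k : ℕ in atTop, ∀ i j, M (2 ^ k) i j ≤ 2 ^ k := by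
    refine eventually_all.2 fun i => eventually_all.2 fun j => ?_
    have hz : 0 < 1 - Z i j := sub_pos.2 (hZ1 i j)
    filter_upwards [hpow.eventually_ge_atTop (n / (1 - Z i j))] with k hk
    rw [div_le_iff₀ hz] at hk
    have h1 := (hM (2 ^ k) i j).2
    push_cast at h1
    have : (M (2 ^ k) i j : ℝ) ≤ ((2 ^ k : ℕ) : ℝ) := by push_cast; linarith
    exact_mod_cast this
  set B := m * Real.log (2 * n) + n * Real.log (2 * m) + (m + n) * Real.log 2 with hB
  have hlogn : 0 ≤ Real.log (2 * n) :=
    Real.log_nonneg (by have : (1 : ℝ) ≤ n := by exact_mod_cast hn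
                        linarith)
  have hlogm : 0 ≤ Real.log (2 * m) :=
    Real.log_nonneg (by have : (1 : ℝ) ≤ m := by exact_mod_cast hm
                        linarith)
  have hlog2 : 0 ≤ Real.log 2 := Real.log_nonneg (by norm_num)
  -- The constant `B` bounds the doubling error per layer. The quotient is `log (2 ^ k + 1) / 2 ^
  -- k`, written in the form of `Real.tendsto_pow_log_div_mul_add_atTop`.
  have hbound : ∀ᶠ k : ℕ in atTop, 0 < gridCount R C 1 ∧
      (∑ i, ∑ j, Real.binEntropy (M (2 ^ k) i j / 2 ^ k)) -
        m * n * (Real.log (2 ^ k + 1) ^ 1 / (1 * (2 ^ k + 1) + -1)) ≤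
        Real.log (gridCount R C 1) + B := by
    filter_upwards [hev] with k hk
    obtain ⟨hpos, h1⟩ := sum_binEntropy_le_log_gridCount (Nat.two_pow_pos k) (M (2 ^ k))
      (hMR _) (hMC _) hk
    refine ⟨gridCount_pos_of_pow R C k hpos, ?_⟩
    have h2 := log_gridCount_le hm hn R C k hpos
    have h2k : (0 : ℝ) < 2 ^ k := by positivity
    have hle : (m * Real.log (2 * n) + n * Real.log (2 * m)) * (2 ^ k - 1) +
      (m + n) * Real.log 2 * (2 ^ k - k - 1) ≤ 2 ^ k * B := by
      have e1 : 0 ≤ m * Real.log (2 * n) + n * Real.log (2 * m) := by positivity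
      have e2 : 0 ≤ (m + n) * Real.log 2 * (k + 1) := by positivity
      rw [hB]
      linarith
    push_cast at h1
    rw [pow_one, one_mul, add_neg_cancel_right, sub_le_iff_le_add,
      ← mul_le_mul_iff_right₀ h2k]
    have e3 : (2 : ℝ) ^ k * (Real.log (gridCount R C 1) + B +
        m * n * (Real.log (2 ^ k + 1) / 2 ^ k)) =
        2 ^ k * Real.log (gridCount R C 1) + 2 ^ k * B + m * n * Real.log (2 ^ k + 1) := by
      field_simp
    rw [e3]
    linarith
  have hMlim : ∀ i j, Tendsto (fun k : ℕ => (M (2 ^ k) i j : ℝ) / 2 ^ k) atTop (𝓝 (Z i j)) := by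
    intro i j
    have hinv : Tendsto (fun k : ℕ => ((2 : ℝ) ^ k)⁻¹) atTop (𝓝 0) :=
      tendsto_inv_atTop_zero.comp hpow
    refine tendsto_of_tendsto_of_tendsto_of_le_of_le
      (g := fun k => Z i j - ((2 : ℝ) ^ k)⁻¹) (h := fun k => Z i j + n * ((2 : ℝ) ^ k)⁻¹) ?_ ?_
      (fun k => ?_) (fun k => ?_)
    · simpa using hinv.const_sub (Z i j)
    · simpa using (hinv.const_mul (n : ℝ)).const_add (Z i j)
    · have h1 := (hM (2 ^ k) i j).1
      push_cast at h1
      change Z i j - ((2 : ℝ) ^ k)⁻¹ ≤ _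
      rw [le_div_iff₀ (by positivity), sub_mul, inv_mul_cancel₀ (by positivity)]
      linarith
    · have h1 := (hM (2 ^ k) i j).2
      push_cast at h1
      change _ ≤ Z i j + n * ((2 : ℝ) ^ k)⁻¹
      rw [div_le_iff₀ (by positivity), add_mul, mul_assoc, inv_mul_cancel₀ (by positivity)]
      linarith
  have hlim : Tendsto (fun k : ℕ => (∑ i, ∑ j, Real.binEntropy (M (2 ^ k) i j / 2 ^ k)) -
        m * n * (Real.log (2 ^ k + 1) ^ 1 / (1 * (2 ^ k + 1) + -1))) atTop
      (𝓝 (entropy Z - m * n * 0)) := by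
    refine Tendsto.sub ?_ (Tendsto.const_mul _ ?_)
    · exact tendsto_finsetSum _ fun i _ => tendsto_finsetSum _ fun j _ =>
        (Real.binEntropy_continuous.tendsto _).comp (hMlim i j)
    · exact (Real.tendsto_pow_log_div_mul_add_atTop 1 (-1) 1 one_ne_zero).comp
        (tendsto_atTop_add_const_right _ 1 hpow)
  rw [mul_zero, sub_zero] at hlim
  obtain ⟨k, hk, -⟩ := hbound.exists
  have hfin := le_of_tendsto hlim (hbound.mono fun k h => h.2)
  have hcount := gridCount_one_le R C
  refine ⟨hk.trans_le hcount, hfin.trans (add_le_add ?_ ?_)⟩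
  · exact Real.log_le_log (by exact_mod_cast hk) (by exact_mod_cast hcount)
  · have hm' : (0 : ℝ) < m := by exact_mod_cast hm
    have hn' : (0 : ℝ) < n := by exact_mod_cast hn
    have hmn' : (m : ℝ) ≤ n := by exact_mod_cast hmn
    have e1 : Real.log (4 * n) = Real.log (2 * n) + Real.log 2 := by
      rw [← Real.log_mul (by positivity) (by norm_num)]
      congr 1
      ring
    have e2 : Real.log (2 * m) ≤ Real.log (2 * n) :=
      Real.log_le_log (by positivity) (by linarith)
    rw [hB, e1]
    have e3 := mul_le_mul_of_nonneg_left e2 hn'.le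
    have e4 := mul_le_mul_of_nonneg_right hmn' hlogn
    have e5 := mul_le_mul_of_nonneg_right hmn' hlog2
    linarith

end Count

end ZeroOneMargins

/-! ### The maximum entropy matrix and Chernoff bounds -/

namespace ZeroOneMargins

open Finset Filter Topology

section Concentration

variable {m n : ℕ} {R : Fin m → ℕ} {C : Fin n → ℕ} {Z : Matrix (Fin m) (Fin n) ℝ}

theorem lineMap_mem_polytope {X Y : Matrix (Fin m) (Fin n) ℝ} (hX : X ∈ polytope R C)
    (hY : Y ∈ polytope R C) {t : ℝ} (ht0 : 0 ≤ t) (ht1 : t ≤ 1) :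
    (fun i j => (1 - t) * X i j + t * Y i j : Matrix (Fin m) (Fin n) ℝ) ∈ polytope R C := by
  refine ⟨fun i => ?_, fun j => ?_, fun i j => ⟨?_, ?_⟩⟩
  · rw [sum_add_distrib, ← mul_sum, ← mul_sum, hX.1 i, hY.1 i]; ring
  · rw [sum_add_distrib, ← mul_sum, ← mul_sum, hX.2.1 j, hY.2.1 j]; ring
  · exact add_nonneg (mul_nonneg (sub_nonneg.2 ht1) (hX.2.2 i j).1)
      (mul_nonneg ht0 (hY.2.2 i j).1)
  · have h1 := mul_le_mul_of_nonneg_left (hX.2.2 i j).2 (sub_nonneg.2 ht1)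
    have h2 := mul_le_mul_of_nonneg_left (hY.2.2 i j).2 ht0
    change (1 - t) * X i j + t * Y i j ≤ 1
    linarith

/-- The maximum entropy matrix has no entry on the boundary. -/
theorem IsMaxEntropyMatrix.entry_mem_Ioo (hZ : IsMaxEntropyMatrix R C Z)
    (hint : HasInterior R C) (i : Fin m) (j : Fin n) : 0 < Z i j ∧ Z i j < 1 := by
  obtain ⟨Y, hY, hY01⟩ := hint
  by_contra hb
  have hz : Z i j = 0 ∨ Z i j = 1 := by
    have := hZ.1.2.2 i j
    by_cases h0 : Z i j = 0
    · exact Or.inl h0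
    · refine Or.inr (le_antisymm this.2 (not_lt.1 fun h => hb ⟨lt_of_le_of_ne this.1 ?_, h⟩))
      exact fun h => h0 h.symm
  -- The symmetry of binary entropy under `x ↦ 1 - x` reduces a boundary value `1` to the value `0`.
  obtain ⟨c, hc0, hc1, hc⟩ : ∃ c : ℝ, 0 < c ∧ c < 1 ∧ ∀ t : ℝ,
      Real.binEntropy ((1 - t) * Z i j + t * Y i j) = Real.binEntropy (t * c) := by
    rcases hz with h | h
    · exact ⟨Y i j, (hY01 i j).1, (hY01 i j).2, fun t => by rw [h]; ring_nf⟩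
    · refine ⟨1 - Y i j, sub_pos.2 (hY01 i j).2, by linarith [(hY01 i j).1], fun t => ?_⟩
      rw [h, ← Real.binEntropy_one_sub]
      ring_nf
  have hz0 : Real.binEntropy (Z i j) = 0 := by rcases hz with h | h <;> simp [h]
  have hH : 0 ≤ entropy Z := sum_nonneg fun i _ => sum_nonneg fun j _ =>
    Real.binEntropy_nonneg (hZ.1.2.2 i j).1 (hZ.1.2.2 i j).2
  -- Binary entropy has infinite slope at `0`. A step of this size towards `Y` gains at least `t *
  -- (entropy Z + 1)` in the boundary entry, while concavity limits the loss elsewhere to `t *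
  -- entropy Z`.
  set t := Real.exp (-((entropy Z + 1) / c)) with ht
  have ht0 : 0 < t := Real.exp_pos _
  have ht1 : t ≤ 1 := Real.exp_le_one_iff.2 (neg_nonpos.2 (by positivity))
  have htc0 : 0 < t * c := mul_pos ht0 hc0
  have htc1 : t * c < 1 := by nlinarith
  have hent : t * (entropy Z + 1) ≤ Real.binEntropy (t * c) := by
    rw [Real.binEntropy]
    have h1 : 0 ≤ (1 - t * c) * Real.log (1 - t * c)⁻¹ :=
      mul_nonneg (by linarith) (Real.log_nonneg (by rw [one_le_inv₀] <;> linarith))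
    have h2 : (entropy Z + 1) / c ≤ Real.log (t * c)⁻¹ := by
      rw [Real.log_inv, Real.log_mul ht0.ne' hc0.ne', ht, Real.log_exp]
      linarith [Real.log_nonpos hc0.le hc1.le]
    have h3 := mul_le_mul_of_nonneg_left h2 htc0.le
    have h4 : t * c * ((entropy Z + 1) / c) = t * (entropy Z + 1) := by field_simp
    linarith
  have hentry : ∀ k l, (1 - t) * Real.binEntropy (Z k l) +
      (if k = i ∧ l = j then t * (entropy Z + 1) else 0) ≤
      Real.binEntropy ((1 - t) * Z k l + t * Y k l) := by
    intro k l
    split_ifs with h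
    · obtain ⟨rfl, rfl⟩ := h
      rw [hz0, hc]
      linarith
    · have h1 := Real.strictConcave_binEntropy.concaveOn.2 (hZ.1.2.2 k l) (hY.2.2 k l)
        (sub_nonneg.2 ht1) ht0.le (by ring)
      simp only [smul_eq_mul] at h1
      have h2 := mul_nonneg ht0.le
        (Real.binEntropy_nonneg (hY.2.2 k l).1 (hY.2.2 k l).2)
      linarith
  have hsum : (1 - t) * entropy Z + t * (entropy Z + 1) ≤
      entropy (fun k l => (1 - t) * Z k l + t * Y k l) := by
    refine le_trans (le_of_eq ?_) (sum_le_sum fun k _ => sum_le_sum fun l _ => hentry k l)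
    simp only [sum_add_distrib, ← mul_sum, ite_and]
    simp [entropy]
  have := hZ.2 _ (lineMap_mem_polytope hZ.1 hY ht0.le ht1)
  linarith

/-- The first order condition at the maximum entropy matrix. -/
theorem IsMaxEntropyMatrix.sum_sub_mul_log_nonneg (hZ : IsMaxEntropyMatrix R C Z)
    (hZ01 : ∀ i j, 0 < Z i j ∧ Z i j < 1) {D : Matrix (Fin m) (Fin n) ℝ} (hD : D ∈ polytope R C) :
    0 ≤ ∑ i, ∑ j, (D i j - Z i j) * (Real.log (Z i j) - Real.log (1 - Z i j)) := by
  have hder : HasDerivAt (fun t : ℝ => entropy fun i j => (1 - t) * Z i j + t * D i j)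
      (∑ i, ∑ j, (Real.log (1 - Z i j) - Real.log (Z i j)) * (D i j - Z i j)) 0 := by
    unfold entropy
    refine HasDerivAt.fun_sum fun i _ => HasDerivAt.fun_sum fun j _ => ?_
    have h1 : HasDerivAt (fun t : ℝ => (1 - t) * Z i j + t * D i j) (D i j - Z i j) 0 := by
      have := (((hasDerivAt_id (0 : ℝ)).const_sub 1).mul_const (Z i j)).add
        ((hasDerivAt_id (0 : ℝ)).mul_const (D i j))
      refine this.congr_deriv ?_
      ring
    have h2 := Real.hasDerivAt_binEntropy (hZ01 i j).1.ne' (hZ01 i j).2.ne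
    refine HasDerivAt.comp (h₂ := Real.binEntropy) (0 : ℝ) ?_ h1
    simpa using h2
  have hslope := (hasDerivWithinAt_iff_tendsto_slope' (s := Set.Ioi (0 : ℝ)) (by simp)).1
    hder.hasDerivWithinAt
  have hle := le_of_tendsto hslope (b := 0) (by
    filter_upwards [Ioo_mem_nhdsGT (show (0 : ℝ) < 1 by norm_num)] with t ht
    have := hZ.2 _ (lineMap_mem_polytope hZ.1 hD ht.1.le ht.2.le)
    rw [slope_def_field]
    refine div_nonpos_of_nonpos_of_nonneg ?_ (by linarith [ht.1])
    simp only [sub_zero, one_mul, zero_mul, add_zero]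
    exact sub_nonpos.2 this)
  have : ∑ i, ∑ j, (D i j - Z i j) * (Real.log (Z i j) - Real.log (1 - Z i j)) =
      -∑ i, ∑ j, (Real.log (1 - Z i j) - Real.log (Z i j)) * (D i j - Z i j) := by
    simp only [← sum_neg_distrib]
    exact sum_congr rfl fun i _ => sum_congr rfl fun j _ => by ring
  linarith

/-- The probability of `x` under the product of Bernoulli measures with means `z`. -/
def bernoulliWeight {E : Type*} [Fintype E] (z : E → ℝ) (x : E → Bool) : ℝ :=
  ∏ e, if x e then z e else 1 - z e

/-- Chernoff's bound, for counting points of given probability. -/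
theorem card_mul_exp_le {E : Type*} [Fintype E] [DecidableEq E] (z : E → ℝ)
    (hz : ∀ e, 0 ≤ z e ∧ z e ≤ 1) (S : Finset E) (T : Finset (E → Bool)) {a b t : ℝ}
    (ht : |t| ≤ 1) (ha : ∀ x ∈ T, a ≤ bernoulliWeight z x)
    (hb : ∀ x ∈ T, b ≤ t * ∑ e ∈ S, ((x e).toNat : ℝ)) :
    #T * (a * Real.exp b) ≤ Real.exp ((∑ e ∈ S, z e) * (t + t ^ 2)) := by
  have hw : ∀ x, 0 ≤ bernoulliWeight z x := fun x => prod_nonneg fun e _ => by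
    split_ifs
    · exact (hz e).1
    · exact sub_nonneg.2 (hz e).2
  calc (#T : ℝ) * (a * Real.exp b) = ∑ _x ∈ T, a * Real.exp b := by simp
    _ ≤ ∑ x ∈ T, bernoulliWeight z x * Real.exp (t * ∑ e ∈ S, ((x e).toNat : ℝ)) :=
        sum_le_sum fun x hx => mul_le_mul (ha x hx) (Real.exp_le_exp.2 (hb x hx))
          (Real.exp_pos _).le (hw x)
    _ ≤ ∑ x, bernoulliWeight z x * Real.exp (t * ∑ e ∈ S, ((x e).toNat : ℝ)) :=
        sum_le_sum_of_subset_of_nonneg (subset_univ _) fun x _ _ =>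
          mul_nonneg (hw x) (Real.exp_pos _).le
    _ = ∑ x : E → Bool, ∏ e, ((if x e then z e else 1 - z e) *
          Real.exp (if e ∈ S then t * ((x e).toNat : ℝ) else 0)) := by
        refine sum_congr rfl fun x _ => ?_
        rw [prod_mul_distrib, ← Real.exp_sum, mul_sum, bernoulliWeight, sum_ite_mem, univ_inter]
    _ = ∏ e, ∑ c : Bool, ((if c then z e else 1 - z e) *
          Real.exp (if e ∈ S then t * (c.toNat : ℝ) else 0)) := by rw [Fintype.prod_sum]
    _ ≤ ∏ e, Real.exp (if e ∈ S then z e * (t + t ^ 2) else 0) := by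
        refine prod_le_prod (fun e _ => sum_nonneg fun c _ => mul_nonneg ?_ (Real.exp_pos _).le)
          fun e _ => ?_
        · split_ifs
          · exact (hz e).1
          · exact sub_nonneg.2 (hz e).2
        · rw [Fintype.sum_bool]
          by_cases h : e ∈ S
          -- The moment generating function is bounded through `exp t ≤ 1 + t + t ^ 2`, valid for
          -- `|t| ≤ 1`, and then `1 + u ≤ exp u`.
          · have h1 := (abs_le.1 (Real.abs_exp_sub_one_sub_id_le ht)).2
            have h2 := Real.add_one_le_exp (z e * (t + t ^ 2))
            have h3 := mul_le_mul_of_nonneg_left h1 (hz e).1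
            simp [h]
            linarith
          · simp [h]
    _ = _ := by rw [← Real.exp_sum, sum_ite_mem, univ_inter, sum_mul]

/-- The set of cells of a 0-1 matrix that hold a one. -/
noncomputable def support (D : Matrix (Fin m) (Fin n) ℝ) (e : Fin m × Fin n) : Bool :=
  decide (D e.1 e.2 = 1)

theorem toNat_support {D : Matrix (Fin m) (Fin n) ℝ} (hD : D ∈ zeroOneMatrices R C)
    (e : Fin m × Fin n) : ((support D e).toNat : ℝ) = D e.1 e.2 := by
  unfold support
  rcases hD.2.2 e.1 e.2 with h | h <;> simp [h]

theorem zeroOneMatrices_subset_polytope : zeroOneMatrices R C ⊆ polytope R C := by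
  refine fun D hD => ⟨hD.1, hD.2.1, fun i j => ?_⟩
  rcases hD.2.2 i j with h | h <;> simp [h]

/-- The log-probability of `D` plus `entropy Z` is exactly the sum that the first order condition
makes nonnegative. -/
theorem IsMaxEntropyMatrix.exp_neg_entropy_le (hZ : IsMaxEntropyMatrix R C Z)
    (hZ01 : ∀ i j, 0 < Z i j ∧ Z i j < 1) {D : Matrix (Fin m) (Fin n) ℝ}
    (hD : D ∈ zeroOneMatrices R C) :
    Real.exp (-entropy Z) ≤ bernoulliWeight (fun e : Fin m × Fin n => Z e.1 e.2) (support D) := by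
  have hpos : ∀ e : Fin m × Fin n, 0 < if support D e then Z e.1 e.2 else 1 - Z e.1 e.2 := by
    intro e
    split_ifs
    · exact (hZ01 _ _).1
    · exact sub_pos.2 (hZ01 _ _).2
  rw [bernoulliWeight, ← Real.le_log_iff_exp_le (prod_pos fun e _ => hpos e),
    Real.log_prod fun e _ => (hpos e).ne', Fintype.sum_prod_type]
  have h := hZ.sum_sub_mul_log_nonneg hZ01 (zeroOneMatrices_subset_polytope hD)
  rw [entropy, ← sum_neg_distrib, ← sub_nonneg, ← sum_sub_distrib]
  refine h.trans (le_of_eq (sum_congr rfl fun i _ => ?_))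
  rw [← sum_neg_distrib, ← sum_sub_distrib]
  refine sum_congr rfl fun j _ => ?_
  rw [Real.binEntropy, Real.log_inv, Real.log_inv]
  rcases hD.2.2 i j with h | h
  · simp only [support, h]
    simp
    ring
  · simp only [support, h]
    simp
    ring

/-- Few 0-1 matrices with given margins satisfy an event that is unlikely for independent
entries. -/
theorem IsMaxEntropyMatrix.ncard_le (hZ : IsMaxEntropyMatrix R C Z)
    (hZ01 : ∀ i j, 0 < Z i j ∧ Z i j < 1) (S : Finset (Fin m × Fin n))
    {A : Set (Matrix (Fin m) (Fin n) ℝ)} (hA : A ⊆ zeroOneMatrices R C) {b t : ℝ} (ht : |t| ≤ 1)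
    (hb : ∀ D ∈ A, b ≤ t * entrySum S D) :
    (A.ncard : ℝ) ≤ Real.exp (entropy Z + (entrySum S Z * (t + t ^ 2) - b)) := by
  classical
  have hfin : A.Finite := (finite_zeroOneMatrices R C).subset hA
  have hinj : Set.InjOn support A := by
    intro D hD D' hD' h
    ext i j
    rw [← toNat_support (hA hD) (i, j), ← toNat_support (hA hD') (i, j), h]
  have hcard : A.ncard = #(hfin.toFinset.image support) := by
    rw [card_image_of_injOn (by simpa using hinj), Set.ncard_eq_toFinset_card A hfin]
  have h := card_mul_exp_le (fun e : Fin m × Fin n => Z e.1 e.2)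
    (fun e => ⟨(hZ01 _ _).1.le, (hZ01 _ _).2.le⟩) S (hfin.toFinset.image support)
    (a := Real.exp (-entropy Z)) (b := b) ht
    (fun x hx => by
      obtain ⟨D, hD, rfl⟩ := mem_image.1 hx
      exact hZ.exp_neg_entropy_le hZ01 (hA (hfin.mem_toFinset.1 hD)))
    (fun x hx => by
      obtain ⟨D, hD, rfl⟩ := mem_image.1 hx
      have hD := hfin.mem_toFinset.1 hD
      simp_rw [toNat_support (hA hD)]
      exact hb D hD)
  rw [← hcard, ← Real.exp_add, ← le_div_iff₀ (Real.exp_pos _), ← Real.exp_sub] at h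
  refine h.trans (le_of_eq (congrArg Real.exp ?_))
  change entrySum S Z * (t + t ^ 2) - (-entropy Z + b) = _
  ring

/-- Both tails use the Chernoff parameter `t = ±ε / 2`, which minimises `t ^ 2 - ε * |t|` and gives
`-ε ^ 2 / 4`. -/
theorem IsMaxEntropyMatrix.ncard_deviation_le (hZ : IsMaxEntropyMatrix R C Z)
    (hZ01 : ∀ i j, 0 < Z i j ∧ Z i j < 1) (S : Finset (Fin m × Fin n)) {ε : ℝ} (hε0 : 0 ≤ ε)
    (hε1 : ε ≤ 1) :
    ((zeroOneMatrices R C \ {D | (1 - ε) * entrySum S Z ≤ entrySum S D ∧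
      entrySum S D ≤ (1 + ε) * entrySum S Z}).ncard : ℝ) ≤
      2 * Real.exp (entropy Z - ε ^ 2 * entrySum S Z / 4) := by
  have hup := hZ.ncard_le hZ01 S (A := {D ∈ zeroOneMatrices R C |
      (1 + ε) * entrySum S Z < entrySum S D}) (fun D hD => hD.1) (t := ε / 2)
    (b := ε / 2 * ((1 + ε) * entrySum S Z)) (by rw [abs_le]; constructor <;> linarith)
    (fun D hD => mul_le_mul_of_nonneg_left hD.2.le (by linarith))
  have hlow := hZ.ncard_le hZ01 S (A := {D ∈ zeroOneMatrices R C |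
      entrySum S D < (1 - ε) * entrySum S Z}) (fun D hD => hD.1) (t := -(ε / 2))
    (b := -(ε / 2) * ((1 - ε) * entrySum S Z)) (by rw [abs_le]; constructor <;> linarith)
    (fun D hD => mul_le_mul_of_nonpos_left hD.2.le (by linarith))
  have e1 : entropy Z + (entrySum S Z * (ε / 2 + (ε / 2) ^ 2) -
      ε / 2 * ((1 + ε) * entrySum S Z)) = entropy Z - ε ^ 2 * entrySum S Z / 4 := by ring
  have e2 : entropy Z + (entrySum S Z * (-(ε / 2) + (-(ε / 2)) ^ 2) -
      -(ε / 2) * ((1 - ε) * entrySum S Z)) = entropy Z - ε ^ 2 * entrySum S Z / 4 := by ring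
  rw [e1] at hup
  rw [e2] at hlow
  have hsub : zeroOneMatrices R C \ {D | (1 - ε) * entrySum S Z ≤ entrySum S D ∧
      entrySum S D ≤ (1 + ε) * entrySum S Z} ⊆
      {D ∈ zeroOneMatrices R C | (1 + ε) * entrySum S Z < entrySum S D} ∪
      {D ∈ zeroOneMatrices R C | entrySum S D < (1 - ε) * entrySum S Z} := by
    rintro D ⟨hD, hnot⟩
    by_cases h : entrySum S D ≤ (1 + ε) * entrySum S Z
    · exact Or.inr ⟨hD, not_le.1 fun h' => hnot ⟨h', h⟩⟩
    · exact Or.inl ⟨hD, not_le.1 h⟩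
  have hfin : ({D ∈ zeroOneMatrices R C | (1 + ε) * entrySum S Z < entrySum S D} ∪
      {D ∈ zeroOneMatrices R C | entrySum S D < (1 - ε) * entrySum S Z}).Finite :=
    ((finite_zeroOneMatrices R C).subset fun D hD => hD.1).union
      ((finite_zeroOneMatrices R C).subset fun D hD => hD.1)
  have h1 := (Set.ncard_le_ncard hsub hfin).trans (Set.ncard_union_le _ _)
  have h2 : ((zeroOneMatrices R C \ {D | (1 - ε) * entrySum S Z ≤ entrySum S D ∧
      entrySum S D ≤ (1 + ε) * entrySum S Z}).ncard : ℝ) ≤ _ := Nat.cast_le.2 h1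
  push_cast at h2
  linarith

theorem uniformProb_eq {α : Type*} {A E : Set α} (hA : A.Finite) (hne : 0 < A.ncard) :
    uniformProb A E = 1 - ((A \ E).ncard : ℝ) / A.ncard := by
  have h := Set.ncard_inter_add_ncard_sdiff_eq_ncard A E hA
  have hpos : (0 : ℝ) < A.ncard := by exact_mod_cast hne
  rw [uniformProb, eq_sub_iff_add_eq, ← add_div, div_eq_one_iff_eq hpos.ne']
  exact_mod_cast h

end Concentration

end ZeroOneMargins

/-! ### Comparing the two counts -/

theorem corollary6p2 (κ δ : ℝ) (hκ : 0 < κ) (hδ0 : 0 < δ) (hδ1 : δ < 1) :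
    ∃ q : ℝ, 0 < q ∧
      ∀ (m n : ℕ), m ≤ n → q < (m : ℝ) →
      ∀ (R : Fin m → ℕ) (C : Fin n → ℕ),
        (∀ i, 0 < R i) → (∀ j, 0 < C j) → ∑ i, R i = ∑ j, C j →
        ZeroOneMargins.HasInterior R C →
      ∀ Z₀ : Matrix (Fin m) (Fin n) ℝ, ZeroOneMargins.IsMaxEntropyMatrix R C Z₀ →
      ∀ S : Finset (Fin m × Fin n),
        δ * (m : ℝ) * (n : ℝ) ≤ ZeroOneMargins.entrySum S Z₀ →
      ∀ ε : ℝ, ε = δ * (Real.log n / Real.sqrt m) → ε ≤ 1 →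
        1 - (n : ℝ) ^ (-(κ * (n : ℝ))) ≤
          ZeroOneMargins.uniformProb (ZeroOneMargins.zeroOneMatrices R C)
            {D | (1 - ε) * ZeroOneMargins.entrySum S Z₀ ≤ ZeroOneMargins.entrySum S D ∧
              ZeroOneMargins.entrySum S D ≤ (1 + ε) * ZeroOneMargins.entrySum S Z₀} := by
  -- In units of `n * log n`, the target costs `κ`, the factor `(4 * n) ^ (2 * n)` costs at most `4`
  -- once `n ≥ 4`, and the factor `2` at most `1`. The Chernoff exponent supplies `δ ^ 3 * log n /
  -- 4`, which must reach `κ + 5`.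
  refine ⟨max 4 (Real.exp (4 * (κ + 5) / δ ^ 3)), lt_max_of_lt_left (by norm_num), ?_⟩
  intro m n hmn hq R C _ _ _ hint Z hZ S hS ε hε hε1
  have hm4 : (4 : ℝ) < m := (le_max_left _ _).trans_lt hq
  have hmn' : (m : ℝ) ≤ n := by exact_mod_cast hmn
  have hn4 : (4 : ℝ) < n := hm4.trans_le hmn'
  have hm : 0 < m := by exact_mod_cast (by linarith : (0 : ℝ) < m)
  have hlog : 4 * (κ + 5) / δ ^ 3 ≤ Real.log n := by
    rw [Real.le_log_iff_exp_le (by linarith)]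
    exact ((le_max_right _ _).trans hq.le).trans hmn'
  have hlog4 : Real.log 4 ≤ Real.log n := Real.log_le_log (by norm_num) hn4.le
  have hlog2 : Real.log 2 ≤ Real.log n := Real.log_le_log (by norm_num) (by linarith)
  have hlog0 : 0 < Real.log n := Real.log_pos (by linarith)
  have hε0 : 0 ≤ ε := by rw [hε]; positivity
  have hZ01 := hZ.entry_mem_Ioo hint
  obtain ⟨hpos, hcount⟩ := ZeroOneMargins.entropy_le_log_ncard hm hmn hZ.1
    fun i j => (hZ01 i j).2
  have hdev := hZ.ncard_deviation_le hZ01 S hε0 hε1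
  rw [ZeroOneMargins.uniformProb_eq (ZeroOneMargins.finite_zeroOneMatrices R C) hpos]
  have hpos' : (0 : ℝ) < (ZeroOneMargins.zeroOneMatrices R C).ncard := by exact_mod_cast hpos
  refine sub_le_sub_left ((div_le_iff₀ hpos').2 (hdev.trans ?_)) 1
  rw [← Real.log_le_log_iff (by positivity) (by positivity),
    Real.log_mul two_ne_zero (Real.exp_pos _).ne', Real.log_exp,
    Real.log_mul (by positivity) hpos'.ne', Real.log_rpow (by linarith)]
  -- The factor `m` in the lower bound for `entrySum S Z` cancels the `m` in the denominator of `ε ^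
  -- 2`.
  have hεσ : δ ^ 3 * (Real.log n ^ 2 * n) ≤ ε ^ 2 * ZeroOneMargins.entrySum S Z := by
    refine le_trans (le_of_eq ?_) (mul_le_mul_of_nonneg_left hS (sq_nonneg ε))
    have hm0 : (m : ℝ) ≠ 0 := by positivity
    rw [hε, mul_pow, div_pow, Real.sq_sqrt (by positivity)]
    field_simp
  have h4n : Real.log (4 * n) = Real.log 4 + Real.log n :=
    Real.log_mul (by norm_num) (by positivity)
  have h1 : 4 * (κ + 5) * (Real.log n * n) ≤ δ ^ 3 * (Real.log n ^ 2 * n) := by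
    rw [div_le_iff₀ (by positivity)] at hlog
    have := mul_le_mul_of_nonneg_right hlog (by positivity : 0 ≤ Real.log n * n)
    linarith
  have h2 : 2 * n * Real.log (4 * n) ≤ 4 * (Real.log n * n) := by
    rw [h4n]
    nlinarith
  have h3 : Real.log 2 ≤ Real.log n * n := by nlinarith
  linarith
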